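/- The following is provable in ZF (Zermelo–Fraenkel set theory without the axiom of choice); equivalently, by the completeness theorem, it holds in every model of ZF, with all notions understood inside the model. Let $\kappa\in \mathrm{On}$ be an infinite cardinal (an infinite initial ordinal) and let $\kappa^+$ be the least cardinal in $\mathrm{On}$ greater than $\kappa$. Then: 1. $\kappa^+\to(\kappa)^1_\kappa$: for every $f:\kappa^+\to\kappa$ there is a set $H\subseteq\kappa^+$ of order type $\kappa$ on which $f$ is constant. 2. $|\mathbb T_{<\kappa}|\le\kappa$: if $T$ is a set of finite sequences of ordinals which is closed under initial segments, and for every $s\in T$ the set $\{\alpha\in \mathrm{On}: s^\frown\alpha\in T\}$ has cardinality less than $\kappa$, then $|T|\le\kappa$. 3. $Regressive(\kappa^+,\kappa)$: for every regressive function $f:\kappa^+\to\kappa^+$ (that is, $f(\xi)<\xi$ for all $0<\xi<\kappa^+$) there is $\alpha<\kappa^+$ with $|f^{-1}\{\alpha\}|\ge\kappa$. 4. $[\kappa^+]^{<\omega}\to\Delta(\kappa)$: every family $\mathcal A$ of finite sets of ordinals with $|\mathcal A|=\kappa^+$ contains a $\Delta$-system $\mathcal B\subseteq\mathcal A$ with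 $|\mathcal B|=\kappa$, where $\mathcal B$ is a $\Delta$-system if there is a set $r$ such that $a\cap b=r$ for all distinct $a,b\in\mathcal B$. 5. $\kappa^+\to(\kappa,\omega+1)$: for every $f:[\kappa^+]^2\to\{0,1\}$ there is either a set $H\subseteq\kappa^+$ of order type $\kappa$ such that $f(\{\alpha,\beta\})=0$ for all distinct $\alpha,\beta\in H$, or a set $H\subseteq\kappa^+$ of order type $\omega+1$ such that $f(\{\alpha,\beta\})=1$ for all distinct $\alpha,\beta\in H$. Here $|X|\le|Y|$ means that there is an injection from $X$ to $Y$, $|X|=|Y|$ that there is a bijection, and $|X|<|Y|$ that $|X|\le|Y|$ and $|X|\ne|Y|$. -/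

import Mathlib

/-! The result is a theorem of ZF, so it is stated about an arbitrary model `M` of first-order ZF
(by the completeness theorem, a sentence holds in all models of ZF iff ZF proves it).
Every notion below is the internal one of the model: all quantifiers range over elements of `M`,
and functions, orderings, cardinalities, natural numbers, ... are sets in the sense of `M`. -/

/-- The only symbol of the language of set theory: binary membership. -/
inductive SetThRel : ℕ → Type
  | mem : SetThRel 2

/-- The first-order language of set theory. -/
def setLang : FirstOrder.Language.{0, 0} := ⟨fun _ => Empty, SetThRel⟩

namespace InZF

variable {M : Type*} [setLang.Structure M]

/-- Membership in the sense of the structure `M`. -/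
def Mem (x y : M) : Prop :=
  FirstOrder.Language.Structure.RelMap (L := setLang) SetThRel.mem ![x, y]

infix:50 " ∈ₘ " => Mem

/-- `x ⊆ y`. -/
def Incl (x y : M) : Prop := ∀ z, z ∈ₘ x → z ∈ₘ y

/-- `x = ∅`. -/
def IsEmp (x : M) : Prop := ∀ z, ¬ z ∈ₘ x

/-- `p = {x, y}`. -/
def IsUPair (p x y : M) : Prop := ∀ z, z ∈ₘ p ↔ z = x ∨ z = y

/-- `s = x ∪ {x}`. -/
def IsSucc (s x : M) : Prop := ∀ z, z ∈ₘ s ↔ z ∈ₘ x ∨ z = x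

variable (M) in
/-- `M` is a model of Zermelo-Fraenkel set theory, without the axiom of choice. The schemas of
separation and replacement range over all classes and class relations of `M` that are
first-order definable in the language of set theory with parameters from `M`. -/
structure IsModelZF : Prop where
  extensionality : ∀ x y : M, (∀ z, z ∈ₘ x ↔ z ∈ₘ y) → x = y
  foundation : ∀ x : M, (∃ y, y ∈ₘ x) → ∃ y, y ∈ₘ x ∧ ∀ z, z ∈ₘ y → ¬ z ∈ₘ x
  pairing : ∀ x y : M, ∃ p, IsUPair p x y
  union : ∀ x : M, ∃ u, ∀ z, z ∈ₘ u ↔ ∃ y, y ∈ₘ x ∧ z ∈ₘ y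
  powerset : ∀ x : M, ∃ p, ∀ z, z ∈ₘ p ↔ Incl z x
  infinity : ∃ w : M, (∃ e, IsEmp e ∧ e ∈ₘ w) ∧ ∀ x, x ∈ₘ w → ∃ s, IsSucc s x ∧ s ∈ₘ w
  separation : ∀ D : Set M, (Set.univ : Set M).Definable₁ setLang D →
    ∀ a : M, ∃ b, ∀ x, x ∈ₘ b ↔ x ∈ₘ a ∧ x ∈ D
  replacement : ∀ R : Set (M × M), (Set.univ : Set M).Definable₂ setLang R →
    ∀ a : M, (∀ x, x ∈ₘ a → ∃! y, (x, y) ∈ R) →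
      ∃ b, ∀ y, y ∈ₘ b ↔ ∃ x, x ∈ₘ a ∧ (x, y) ∈ R

/-! ### Functions and cardinality -/

/-- `p = (x, y)`, the Kuratowski ordered pair. -/
def IsOPair (p x y : M) : Prop := ∃ s d, IsUPair s x x ∧ IsUPair d x y ∧ IsUPair p s d

/-- `(x, y) ∈ f`; for a function `f` this says `f(x) = y`. -/
def PairMem (f x y : M) : Prop := ∃ p, IsOPair p x y ∧ p ∈ₘ f

/-- `f` is a function from `A` to `B`. -/
def IsFunc (f A B : M) : Prop :=
  (∀ p, p ∈ₘ f → ∃ x y, x ∈ₘ A ∧ y ∈ₘ B ∧ IsOPair p x y) ∧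
    ∀ x, x ∈ₘ A → ∃! y, PairMem f x y

/-- Distinct arguments have distinct values. -/
def IsInj (f : M) : Prop := ∀ x x' y, PairMem f x y → PairMem f x' y → x = x'

/-- Every element of `B` is a value of `f`. -/
def IsOnto (f B : M) : Prop := ∀ y, y ∈ₘ B → ∃ x, PairMem f x y

/-- `|A| ≤ |B|`: there is an injection from `A` to `B`. -/
def CardLE (A B : M) : Prop := ∃ f, IsFunc f A B ∧ IsInj f

/-- `|A| = |B|`: there is a bijection from `A` to `B`. -/
def CardEq (A B : M) : Prop := ∃ f, IsFunc f A B ∧ IsInj f ∧ IsOnto f B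

/-- `|A| < |B|`. -/
def CardLT (A B : M) : Prop := CardLE A B ∧ ¬ CardEq A B

/-! ### Ordinals and cardinals -/

/-- `α` is a (von Neumann) ordinal: a transitive set linearly ordered by membership
(well-foundedness is the axiom of foundation). The ordering of ordinals is `∈ₘ`. -/
def IsOrd (α : M) : Prop :=
  (∀ x, x ∈ₘ α → Incl x α) ∧ ∀ x y, x ∈ₘ α → y ∈ₘ α → x ∈ₘ y ∨ x = y ∨ y ∈ₘ x

/-- `n` is a natural number: an ordinal such that each ordinal `≤ n` is `0` or a successor. -/
def IsNat (n : M) : Prop :=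
  IsOrd n ∧ ∀ m, m ∈ₘ n ∨ m = n → IsEmp m ∨ ∃ k, IsSucc m k

/-- `A` is a finite set. -/
def IsFin (A : M) : Prop := ∃ n, IsNat n ∧ CardEq A n

/-- `w = ω`. -/
def IsOmega (w : M) : Prop := ∀ n, n ∈ₘ w ↔ IsNat n

/-- `κ` is a cardinal in `On`: an ordinal not equinumerous with any smaller ordinal. -/
def IsCard (κ : M) : Prop := IsOrd κ ∧ ∀ β, β ∈ₘ κ → ¬ CardEq β κ

/-- `κ` is an infinite cardinal in `On`. -/
def IsInfCard (κ : M) : Prop := IsCard κ ∧ ¬ IsFin κ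

/-- `μ = κ⁺`: `μ` is the least cardinal in `On` above `κ`. -/
def IsSuccCard (μ κ : M) : Prop :=
  IsCard μ ∧ κ ∈ₘ μ ∧ ∀ ν, IsCard ν → κ ∈ₘ ν → μ = ν ∨ μ ∈ₘ ν

/-- The set of ordinals `H` has order type `α`: there is an increasing map of `α` onto `H`. -/
def HasOrderType (H α : M) : Prop :=
  ∃ f, IsFunc f α H ∧ IsOnto f H ∧
    ∀ x x' y y', PairMem f x y → PairMem f x' y' → x ∈ₘ x' → y ∈ₘ y'

/-! ### Partition relations -/

/-- `μ → (lam)^1_κ`: every colouring of the points of `μ` with `κ` colours has a homogeneous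
(i.e. monochromatic) set of order type `lam`. -/
def ArrowOne (μ lam κ : M) : Prop :=
  ∀ f, IsFunc f μ κ →
    ∃ H i, Incl H μ ∧ HasOrderType H lam ∧ ∀ x, x ∈ₘ H → PairMem f x i

/-- `D = [A]²`, the set of all two-element subsets of `A`. -/
def IsPairsOf (D A : M) : Prop :=
  ∀ d, d ∈ₘ D ↔ ∃ x y, x ∈ₘ A ∧ y ∈ₘ A ∧ x ≠ y ∧ IsUPair d x y

/-- `f({x, y}) = i` for all distinct elements `x`, `y` of `H`. -/
def IsHomog (f H i : M) : Prop :=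
  ∀ x y d, x ∈ₘ H → y ∈ₘ H → x ≠ y → IsUPair d x y → PairMem f d i

/-- `μ → (α, β)` (exponent 2): for every `f : [μ]² → 2 = {0, 1}` there is a `0`-homogeneous set
of order type `α` or a `1`-homogeneous set of order type `β`. -/
def ArrowTwo (μ α β : M) : Prop :=
  ∀ zero one two D f, IsEmp zero → IsSucc one zero → IsSucc two one →
    IsPairsOf D μ → IsFunc f D two →
    (∃ H, Incl H μ ∧ HasOrderType H α ∧ IsHomog f H zero) ∨
      ∃ H, Incl H μ ∧ HasOrderType H β ∧ IsHomog f H one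

/-! ### Trees of finite sequences of ordinals -/

/-- `s` is a finite sequence of ordinals of length `n`: a function from the natural number `n`
to the ordinals. -/
def IsOrdSeq (s n : M) : Prop :=
  IsNat n ∧ (∀ p, p ∈ₘ s → ∃ i a, i ∈ₘ n ∧ IsOrd a ∧ IsOPair p i a) ∧
    ∀ i, i ∈ₘ n → ∃! a, PairMem s i a

/-- `T ⊆ On^{<ω}` is a tree: a set of finite sequences of ordinals that contains
all initial segments of its elements. -/
def IsTree (T : M) : Prop :=
  (∀ s, s ∈ₘ T → ∃ n, IsOrdSeq s n) ∧
    ∀ t s m, t ∈ₘ T → IsOrdSeq s m → Incl s t → s ∈ₘ T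

/-- `t` is the sequence `s` extended by the one further term `a`. -/
def IsSnoc (t s a : M) : Prop :=
  ∃ n, IsOrdSeq s n ∧ ∀ p, p ∈ₘ t ↔ p ∈ₘ s ∨ IsOPair p n a

/-- For every `s ∈ T` the set of ordinals `a` such that `s ⌢ a ∈ T` has size `< κ`. -/
def IsBranchingLT (T κ : M) : Prop :=
  ∀ s, s ∈ₘ T → ∃ B, (∀ a, a ∈ₘ B ↔ IsOrd a ∧ ∃ t, t ∈ₘ T ∧ IsSnoc t s a) ∧ CardLT B κ

/-- `|𝕋_{<κ}| ≤ lam`: every `<κ`-branching tree of finite sequences of ordinals has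
size `≤ lam`. -/
def TreeBound (κ lam : M) : Prop := ∀ T, IsTree T → IsBranchingLT T κ → CardLE T lam

/-! ### Regressive functions and Δ-systems -/

/-- `f : μ → μ` is regressive: `f(ξ) < ξ` for all `ξ ∈ μ` other than `0`. -/
def IsRegressive (f μ : M) : Prop :=
  IsFunc f μ μ ∧ ∀ x y, PairMem f x y → ¬ IsEmp x → y ∈ₘ x

/-- `Regressive(μ, lam)`: every regressive `f : μ → μ` has a value `a < μ` whose preimage
`f⁻¹{a}` has size at least `lam`. -/
def Regressive (μ lam : M) : Prop :=
  ∀ f, IsRegressive f μ →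
    ∃ a P, a ∈ₘ μ ∧ (∀ x, x ∈ₘ P ↔ x ∈ₘ μ ∧ PairMem f x a) ∧ CardLE lam P

/-- `B` is a Δ-system: any two distinct elements of `B` have the same intersection `r`. -/
def IsDeltaSystem (B : M) : Prop :=
  ∃ r, ∀ a b, a ∈ₘ B → b ∈ₘ B → a ≠ b → ∀ x, x ∈ₘ r ↔ x ∈ₘ a ∧ x ∈ₘ b

/-- `[μ]^{<ω} → Δ(lam)`: every family of size `μ` of finite sets of ordinals contains a
Δ-system of size `lam`. -/
def DeltaArrow (μ lam : M) : Prop :=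
  ∀ A, (∀ a, a ∈ₘ A → IsFin a ∧ ∀ x, x ∈ₘ a → IsOrd x) → CardEq A μ →
    ∃ B, Incl B A ∧ CardEq B lam ∧ IsDeltaSystem B

end InZF

open InZF

/-!
The axioms of ZF are available in `M` only for first-order definable classes, so definability is set
up as a class (`DefPred`, `DefMap`) that instance search verifies along the syntax of a predicate or
a term. After that, sets of `M` are handled through ordinary functions and predicates on `M`:
separation and replacement become `sep` and `image`, and definite descriptions (`the`) turn every
definable functional relation into a definable function.

Choice is avoided by using only canonical injections. A set `S` of ordinals has a canonical ranking
`rk S` onto its order type, obtained by collapsing, and if `S` has no subset of order type `κ` then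
the ranking maps `S` into `κ` (`exists_hasOrderType`). Together with the canonical pairing function
on an infinite cardinal `κ` (`IsInfCard.exists_pairing`) this shows that a `<κ`-branching tree has
size at most `κ`, as long as its branchings are uniformly sets of ordinals: a node is coded by the
code of its parent and its rank among the children (`exists_tree`). No part of this needs `κ⁺` to be
regular.

In each of the statements about `κ⁺`, a counterexample would give such codes for all elements of
`κ⁺`, so that `κ⁺` would embed into `κ`.
* For a colouring of `κ⁺` by `κ` colours without a monochromatic set of order type `κ`, a point is
  coded by its colour and its rank in its colour class.
* Trees of finite sequences of ordinals are a direct case of `exists_tree`.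
* If `f` is regressive with small fibres, the sets `{0, …, f (f ξ), f ξ, ξ}` form a small tree.
* For a family of finite sets, each finite set `r` gives a greedy Δ-subsystem `B r` with root `r`.
  If all of these are small, let the tree extend `r` by the elements of `⋃ B r` outside `r`. By
  maximality of `B r` a member of the family that properly contains `r` meets this set outside `r`,
  so that every member is a node of the tree.
* For a colouring of pairs, a finite set `r` gives the greedy `0`-homogeneous set `B r` among the
  points `ξ` that lie above `r` and are joined to it by the colour `1`. If all of these are small,
  the tree that extends `r` by elements of `B r` is small. Given `ξ`, one starts with `r = ∅` and,
  while `ξ ∉ B r`, adds to `r` the least element of `B r` below `ξ` that is joined to `ξ` by the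
  colour `1`. If this never ends, the elements added and `ξ` form a `1`-homogeneous set of order
  type `ω + 1`. If it ends, `ξ` is the last element of a node of the tree.
-/

namespace InZF

/-! ### Definability with parameters -/

section Definability

open Classical in
/-- The unique `y` with `P y`; an arbitrary fixed element if there is no such `y`. -/
noncomputable def the {M : Type*} [Nonempty M] (P : M → Prop) : M :=
  if h : ∃! y, P y then h.choose else Classical.arbitrary M

theorem the_spec {M : Type*} [Nonempty M] {P : M → Prop} (h : ∃! y, P y) : P (the P) := by
  rw [the, dif_pos h]; exact h.choose_spec.1

theorem the_eq {M : Type*} [Nonempty M] {P : M → Prop} {y : M} (h : P y) (hu : ∀ z, P z → z = y) :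
    the P = y :=
  hu _ (the_spec ⟨y, h, hu⟩)

variable {M : Type*} [setLang.Structure M] {n m : ℕ}

/-- The newest variable of a context `v` of `n + 1` variables; a quantifier adds a new one. -/
def last (v : Fin (n + 1) → M) : M := v 0

/-- The context `v` without its newest variable. -/
def init (v : Fin (n + 1) → M) : Fin n → M := fun i => v i.succ

/-- `P` is first-order definable with parameters from `M`, in a context of `n` variables.
It is a class so that definability is checked by instance search, along the syntax of `P`. -/
class DefPred (P : (Fin n → M) → Prop) : Prop where
  out : (Set.univ : Set M).Definable setLang {v | P v}

/-- The function `t` has a graph definable with parameters from `M`. -/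
class DefMap (t : (Fin n → M) → M) : Prop where
  out : DefPred fun w : Fin (n + 1) → M => last w = t (init w)

/-- A definable class. In contrast to `DefPred` this can be assumed of an unspecified `P`, which may
then be applied to terms in any context. Contexts are written `0 + 1`, `0 + 1 + 1`, … so that they
unify with `n + 1`. -/
class DefPred₁ (P : M → Prop) : Prop where
  out : DefPred fun v : Fin (0 + 1) → M => P (last v)

/-- A definable class of pairs. -/
class DefPred₂ (P : M → M → Prop) : Prop where
  out : DefPred fun v : Fin (0 + 1 + 1) → M => P (last (init v)) (last v)

/-- A definable class function. -/
class DefMap₁ (F : M → M) : Prop where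
  out : DefMap fun v : Fin (0 + 1) → M => F (last v)

/-- A definable class function of two variables. -/
class DefMap₂ (F : M → M → M) : Prop where
  out : DefMap fun v : Fin (0 + 1 + 1) → M => F (last (init v)) (last v)

/-- `p` selects variables of a context. Instances exist for the maps that forget the newest ones. -/
class IsInit (p : (Fin n → M) → Fin m → M) : Prop where
  out : ∃ f : Fin m → Fin n, ∀ v, p v = v ∘ f

instance isInit_id : IsInit (fun v : Fin n → M => v) := ⟨id, fun _ => rfl⟩

-- instance search sees the function `fun v => init v` in its η-reduced form
instance isInit_init : IsInit (init : (Fin (n + 1) → M) → Fin n → M) := ⟨Fin.succ, fun _ => rfl⟩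

instance isInit_init_comp (p : (Fin n → M) → Fin (m + 1) → M) [h : IsInit p] :
    IsInit fun v => init (p v) := by
  obtain ⟨f, hf⟩ := h.out
  exact ⟨⟨fun i => f i.succ, fun v => by rw [hf]; rfl⟩⟩

theorem DefPred.of_iff {P Q : (Fin n → M) → Prop} (h : DefPred P) (e : ∀ v, Q v ↔ P v) :
    DefPred Q := by
  rwa [show Q = P from funext fun v => propext (e v)]

theorem DefPred.reindex {P : (Fin n → M) → Prop} (h : DefPred P) (f : Fin n → Fin m) :
    DefPred fun v : Fin m → M => P (v ∘ f) :=
  ⟨h.out.preimage_comp f⟩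

section Connectives

variable {P Q : (Fin n → M) → Prop}

instance DefPred.and [hP : DefPred P] [hQ : DefPred Q] : DefPred fun v => P v ∧ Q v :=
  ⟨hP.out.inter hQ.out⟩

instance DefPred.or [hP : DefPred P] [hQ : DefPred Q] : DefPred fun v => P v ∨ Q v :=
  ⟨hP.out.union hQ.out⟩

instance DefPred.not [hP : DefPred P] : DefPred fun v => ¬ P v :=
  ⟨hP.out.compl⟩

instance DefPred.imp [DefPred P] [DefPred Q] : DefPred fun v => P v → Q v :=
  .of_iff (P := fun v => ¬ P v ∨ Q v) inferInstance fun _ => imp_iff_not_or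

instance DefPred.iff [DefPred P] [DefPred Q] : DefPred fun v => P v ↔ Q v :=
  .of_iff (P := fun v => (P v → Q v) ∧ (Q v → P v)) inferInstance
    fun _ => iff_iff_implies_and_implies

instance DefPred.const (p : Prop) : DefPred fun _ : Fin n → M => p := by
  by_cases h : p
  · exact .of_iff ⟨Set.definable_univ⟩ fun _ => iff_true_intro h
  · exact .of_iff ⟨Set.definable_empty⟩ fun _ => iff_false_intro h

end Connectives

instance DefPred.exists (P : (Fin n → M) → M → Prop)
    [h : DefPred fun w : Fin (n + 1) → M => P (init w) (last w)] :
    DefPred fun v => ∃ y, P v y := by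
  refine .of_iff ⟨h.out.image_comp (Fin.succ : Fin n → Fin (n + 1))⟩ fun v => ?_
  constructor
  · rintro ⟨y, hy⟩
    exact ⟨Fin.cons y v, hy, rfl⟩
  · rintro ⟨w, hw, rfl⟩
    exact ⟨_, hw⟩

instance DefPred.forall (P : (Fin n → M) → M → Prop)
    [DefPred fun w : Fin (n + 1) → M => P (init w) (last w)] :
    DefPred fun v => ∀ y, P v y :=
  .of_iff (P := fun v => ¬ ∃ y, ¬ P v y) inferInstance fun _ => by simp

theorem DefPred.eq_var (i j : Fin n) : DefPred fun v : Fin n → M => v i = v j :=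
  ⟨⟨FirstOrder.Language.Term.equal (.var i) (.var j), by ext; simp⟩⟩

theorem DefPred.eq_const (i : Fin n) (c : M) : DefPred fun v : Fin n → M => v i = c :=
  ⟨⟨(FirstOrder.Language.Term.var i).equal
    (setLang.con (⟨c, trivial⟩ : (Set.univ : Set M))).term, by ext; simp⟩⟩

theorem DefPred.mem_var (i j : Fin n) : DefPred fun v : Fin n → M => v i ∈ₘ v j := by
  let R : setLang.Relations 2 := SetThRel.mem
  refine ⟨Set.Definable.mono (A := ∅) (Set.empty_definable_iff.2
    ⟨R.formula₂ (.var i) (.var j), ?_⟩) (Set.empty_subset _)⟩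
  ext v
  rw [Set.mem_ofPred_eq, Set.mem_ofPred_eq, FirstOrder.Language.Formula.realize_rel₂]
  rfl

instance DefMap.var (p : (Fin n → M) → Fin (m + 1) → M) [h : IsInit p] :
    DefMap fun v => last (p v) := by
  obtain ⟨f, hf⟩ := h.out
  refine ⟨.of_iff (DefPred.eq_var (0 : Fin (n + 1)) (f 0).succ) fun w => ?_⟩
  rw [hf]; rfl

-- instance search sees the function `fun v => last v` in its η-reduced form
instance defMap_last : DefMap (last : (Fin (n + 1) → M) → M) :=
  DefMap.var fun v => v

instance (priority := high) DefMap.const (c : M) : DefMap fun _ : Fin n → M => c :=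
  ⟨DefPred.eq_const 0 c⟩

theorem DefPred.weaken {P : (Fin n → M) → Prop} (h : DefPred P) :
    DefPred fun w : Fin (n + 1) → M => P (init w) :=
  h.reindex Fin.succ

/-- Substitution of a definable term for the newest variable. -/
theorem DefPred.subst {P : (Fin n → M) → M → Prop}
    (h : DefPred fun w : Fin (n + 1) → M => P (init w) (last w))
    (t : (Fin n → M) → M) [ht : DefMap t] : DefPred fun v => P v (t v) := by
  have := ht.out
  exact .of_iff (DefPred.exists fun v y => y = t v ∧ P v y) fun v => by simp

theorem DefMap.weaken {t : (Fin n → M) → M} (h : DefMap t) :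
    DefMap fun w : Fin (n + 1) → M => t (init w) :=
  ⟨h.out.reindex (Fin.cons 0 fun i => i.succ.succ)⟩

/-- Substitution of two definable terms into a predicate of two further variables. -/
theorem DefPred.subst₂ {P : M → M → Prop}
    (h : DefPred fun w : Fin (n + 1 + 1) → M => P (last (init w)) (last w))
    (s t : (Fin n → M) → M) [hs : DefMap s] [ht : DefMap t] : DefPred fun v => P (s v) (t v) := by
  have := hs.weaken
  have := ht.weaken
  exact DefPred.subst (P := fun v x => P x (t v))
    (DefPred.subst (P := fun w y => P (last w) y) h _) s

instance DefPred.mem (s t : (Fin n → M) → M) [DefMap s] [DefMap t] :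
    DefPred fun v => s v ∈ₘ t v :=
  DefPred.subst₂ (DefPred.mem_var 1 0) s t

instance DefPred.eq (s t : (Fin n → M) → M) [DefMap s] [DefMap t] :
    DefPred fun v => s v = t v :=
  DefPred.subst₂ (DefPred.eq_var 1 0) s t

instance DefPred.ne (s t : (Fin n → M) → M) [DefMap s] [DefMap t] :
    DefPred fun v => s v ≠ t v :=
  inferInstanceAs <| DefPred fun v => ¬ s v = t v

/-! ### Change of context -/

/-- A term may be used in any larger context. The variants below have further arguments that do not
come from the smaller context. -/
instance (priority := low) DefMap.comp_init (t : (Fin m → M) → M) [h : DefMap t]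
    (p : (Fin n → M) → Fin m → M) [hp : IsInit p] : DefMap fun v => t (p v) := by
  obtain ⟨f, hf⟩ := hp.out
  exact ⟨.of_iff (h.out.reindex (Fin.cons 0 fun i => (f i).succ)) fun v => by rw [hf]; rfl⟩

instance (priority := low) DefPred.comp_init₁ (P : (Fin m → M) → M → Prop)
    [h : DefPred fun w : Fin (m + 1) → M => P (init w) (last w)]
    (p : (Fin n → M) → Fin m → M) [hp : IsInit p] (t : (Fin n → M) → M) [DefMap t] :
    DefPred fun v => P (p v) (t v) := by
  obtain ⟨f, hf⟩ := hp.out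
  exact DefPred.subst (P := fun v y => P (p v) y)
    (.of_iff (h.reindex (Fin.cons 0 fun i => (f i).succ)) fun v => by rw [hf]; rfl) t

instance (priority := low) DefPred.comp_init₂ (P : (Fin m → M) → M → M → Prop)
    [h : DefPred fun w : Fin (m + 1 + 1) → M => P (init (init w)) (last (init w)) (last w)]
    (p : (Fin n → M) → Fin m → M) [hp : IsInit p] (s t : (Fin n → M) → M) [DefMap s] [DefMap t] :
    DefPred fun v => P (p v) (s v) (t v) := by
  obtain ⟨f, hf⟩ := hp.out
  exact DefPred.subst (P := fun v y => P (p v) (s v) y)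
    (DefPred.subst (P := fun w x => P (p (init w)) x (last w))
      (.of_iff (h.reindex (Fin.cons 1 (Fin.cons 0 fun i => (f i).succ.succ)))
        fun v => by rw [hf]; rfl) fun w => s (init w)) t

instance (priority := low) DefMap.comp_init₁ (F : (Fin m → M) → M → M)
    [h : DefMap fun w : Fin (m + 1) → M => F (init w) (last w)]
    (p : (Fin n → M) → Fin m → M) [hp : IsInit p] (t : (Fin n → M) → M) [ht : DefMap t] :
    DefMap fun v => F (p v) (t v) := by
  obtain ⟨f, hf⟩ := hp.out
  exact ⟨DefPred.subst (P := fun w y => last w = F (p (init w)) y)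
    (.of_iff (h.out.reindex (Fin.cons 1 (Fin.cons 0 fun i => (f i).succ.succ)))
      fun v => by rw [hf]; rfl) fun w => t (init w)⟩

instance (priority := low) DefMap.comp_init₂ (F : (Fin m → M) → M → M → M)
    [h : DefMap fun w : Fin (m + 1 + 1) → M => F (init (init w)) (last (init w)) (last w)]
    (p : (Fin n → M) → Fin m → M) [hp : IsInit p] (s t : (Fin n → M) → M) [DefMap s] [DefMap t] :
    DefMap fun v => F (p v) (s v) (t v) := by
  obtain ⟨f, hf⟩ := hp.out
  exact ⟨DefPred.subst (P := fun w y => last w = F (p (init w)) (s (init w)) y)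
    (DefPred.subst (P := fun w x => last (init w) = F (p (init (init w))) x (last w))
      (.of_iff (h.out.reindex (Fin.cons 2 (Fin.cons 1 (Fin.cons 0 fun i => (f i).succ.succ.succ))))
        fun v => by rw [hf]; rfl) fun w => s (init (init w))) fun w => t (init w)⟩

instance DefPred.existsUnique (P : (Fin n → M) → M → Prop)
    [h : DefPred fun w : Fin (n + 1) → M => P (init w) (last w)] :
    DefPred fun v => ∃! y, P v y := by
  have : DefPred fun w : Fin (n + 1 + 1) → M => P (init (init w)) (last w) :=
    h.reindex (Fin.cons 0 fun i => i.succ.succ)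
  exact DefPred.exists fun v y => P v y ∧ ∀ z, P v z → z = y

instance (priority := low) DefPred.comp₁ (P : M → Prop) [h : DefPred₁ P]
    (t : (Fin n → M) → M) [DefMap t] : DefPred fun v => P (t v) :=
  DefPred.subst (P := fun _ y => P y) (h.out.reindex fun _ => 0) t

instance (priority := low) DefPred.comp₂ (P : M → M → Prop) [h : DefPred₂ P]
    (s t : (Fin n → M) → M) [DefMap s] [DefMap t] : DefPred fun v => P (s v) (t v) :=
  DefPred.subst₂ (h.out.reindex ![0, 1]) s t

instance (priority := low) DefMap.comp₁ (F : M → M) [h : DefMap₁ F]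
    (t : (Fin n → M) → M) [ht : DefMap t] : DefMap fun v => F (t v) := by
  have := ht.weaken
  exact ⟨DefPred.subst₂ (P := fun x y => y = F x) (h.out.out.reindex ![0, 1])
    (fun w => t (init w)) (fun w => last w) |>.of_iff fun _ => Iff.rfl⟩

instance (priority := low) DefMap.comp₂ (F : M → M → M) [h : DefMap₂ F]
    (s t : (Fin n → M) → M) [hs : DefMap s] [ht : DefMap t] : DefMap fun v => F (s v) (t v) := by
  have := hs.weaken
  have := ht.weaken.weaken
  have : DefPred fun w : Fin (n + 1 + 1 + 1) → M =>
      last (init (init w)) = F (last (init w)) (last w) :=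
    h.out.out.reindex ![2, 0, 1]
  have : DefPred fun w : Fin (n + 1 + 1) → M => last (init w) = F (last w) (t (init (init w))) :=
    DefPred.subst (P := fun w y => last (init w) = F (last w) y) this _
  exact ⟨DefPred.subst (P := fun w x => last w = F x (t (init w))) this _⟩

instance (priority := low) DefPred₁.intro (P : M → Prop)
    [h : DefPred fun v : Fin (0 + 1) → M => P (last v)] : DefPred₁ P := ⟨h⟩

instance (priority := low) DefPred₂.intro (P : M → M → Prop)
    [h : DefPred fun v : Fin (0 + 1 + 1) → M => P (last (init v)) (last v)] : DefPred₂ P := ⟨h⟩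

instance (priority := low) DefMap₁.intro (F : M → M)
    [h : DefMap fun v : Fin (0 + 1) → M => F (last v)] : DefMap₁ F := ⟨h⟩

instance (priority := low) DefMap₂.intro (F : M → M → M)
    [h : DefMap fun v : Fin (0 + 1 + 1) → M => F (last (init v)) (last v)] : DefMap₂ F := ⟨h⟩

instance defMap_the [Nonempty M] (P : (Fin n → M) → M → Prop)
    [h : DefPred fun w : Fin (n + 1) → M => P (init w) (last w)] :
    DefMap fun v => the (P v) := by
  have : DefPred fun w : Fin (n + 1 + 1) → M => P (init (init w)) (last w) :=
    h.reindex (Fin.cons 0 fun i => i.succ.succ)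
  refine ⟨.of_iff (P := fun w : Fin (n + 1) → M =>
    ((∃! y, P (init w) y) ∧ P (init w) (last w)) ∨
      ((¬ ∃! y, P (init w) y) ∧ last w = Classical.arbitrary M)) inferInstance fun w => ?_⟩
  by_cases hu : ∃! y, P (init w) y
  · have : P (init w) (last w) ↔ last w = the (P (init w)) :=
      ⟨fun h' => hu.unique h' (the_spec hu), fun h' => h' ▸ the_spec hu⟩
    simp [hu, this]
  · simp only [hu, InZF.the]; simp

instance DefMap.ite (P : (Fin n → M) → Prop) {d : ∀ v, Decidable (P v)} (s t : (Fin n → M) → M)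
    [hP : DefPred P] [hs : DefMap s] [ht : DefMap t] :
    DefMap fun v => if P v then s v else t v := by
  have := hP.weaken
  have := hs.weaken
  have := ht.weaken
  refine ⟨.of_iff (P := fun w : Fin (n + 1) → M =>
    (P (init w) ∧ last w = s (init w)) ∨ (¬ P (init w) ∧ last w = t (init w)))
    inferInstance fun w => ?_⟩
  by_cases h : P (init w) <;> simp [h]

end Definability

/-! ### Elementary set theory in the model -/

/-- The class form of `IsModelZF`, so that the axioms are found by instance search. -/
class ZFModel (M : Type*) [setLang.Structure M] : Prop where
  out : IsModelZF M

section Structure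

variable {M : Type*} [setLang.Structure M] {n : ℕ} (s t r : (Fin n → M) → M)

instance DefPred.incl [DefMap s] [DefMap t] : DefPred fun v => Incl (s v) (t v) := by
  unfold Incl; infer_instance

instance DefPred.isEmp [DefMap s] : DefPred fun v => IsEmp (s v) := by
  unfold IsEmp; infer_instance

instance DefPred.isUPair [DefMap r] [DefMap s] [DefMap t] :
    DefPred fun v => IsUPair (r v) (s v) (t v) := by
  unfold IsUPair; infer_instance

instance DefPred.isSucc [DefMap s] [DefMap t] : DefPred fun v => IsSucc (s v) (t v) := by
  unfold IsSucc; infer_instance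

instance DefPred.isOPair [DefMap r] [DefMap s] [DefMap t] :
    DefPred fun v => IsOPair (r v) (s v) (t v) := by
  unfold IsOPair; infer_instance

instance DefPred.pairMem [DefMap r] [DefMap s] [DefMap t] :
    DefPred fun v => PairMem (r v) (s v) (t v) := by
  unfold PairMem; infer_instance

instance DefPred.isFunc [DefMap r] [DefMap s] [DefMap t] :
    DefPred fun v => IsFunc (r v) (s v) (t v) := by
  unfold IsFunc; infer_instance

instance DefPred.isInj [DefMap s] : DefPred fun v => IsInj (s v) := by
  unfold IsInj; infer_instance

instance DefPred.isOnto [DefMap s] [DefMap t] : DefPred fun v => IsOnto (s v) (t v) := by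
  unfold IsOnto; infer_instance

instance DefPred.cardLE [DefMap s] [DefMap t] : DefPred fun v => CardLE (s v) (t v) := by
  unfold CardLE; infer_instance

instance DefPred.cardEq [DefMap s] [DefMap t] : DefPred fun v => CardEq (s v) (t v) := by
  unfold CardEq; infer_instance

instance DefPred.isOrd [DefMap s] : DefPred fun v => IsOrd (s v) := by
  unfold IsOrd; infer_instance

instance DefPred.isNat [DefMap s] : DefPred fun v => IsNat (s v) := by
  unfold IsNat; infer_instance

instance DefPred.isFin [DefMap s] : DefPred fun v => IsFin (s v) := by
  unfold IsFin; infer_instance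

instance DefPred.isCard [DefMap s] : DefPred fun v => IsCard (s v) := by
  unfold IsCard; infer_instance

instance DefPred.isInfCard [DefMap s] : DefPred fun v => IsInfCard (s v) := by
  unfold IsInfCard; infer_instance

instance DefPred.isOrdSeq [DefMap s] [DefMap t] : DefPred fun v => IsOrdSeq (s v) (t v) := by
  unfold IsOrdSeq; infer_instance

theorem Incl.refl (x : M) : Incl x x := fun _ h => h

theorem CardEq.cardLE {A B : M} (h : CardEq A B) : CardLE A B :=
  let ⟨f, hf, hi, _⟩ := h; ⟨f, hf, hi⟩

end Structure

variable {M : Type*} [setLang.Structure M] [hZF : ZFModel M] {n : ℕ}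

instance ZFModel.nonempty : Nonempty M :=
  ⟨hZF.out.infinity.choose⟩

theorem ext {x y : M} (h : ∀ z, z ∈ₘ x ↔ z ∈ₘ y) : x = y :=
  hZF.out.extensionality x y h

theorem Incl.antisymm {x y : M} (h : Incl x y) (h' : Incl y x) : x = y :=
  ext fun z => ⟨h z, h' z⟩

/-- By extensionality, a set is uniquely described by its elements. -/
theorem the_set_spec {P : M → Prop} (h : ∃ b, ∀ x, x ∈ₘ b ↔ P x) (x : M) :
    x ∈ₘ the (fun b => ∀ x, x ∈ₘ b ↔ P x) ↔ P x := by
  obtain ⟨b, hb⟩ := h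
  exact the_spec (P := fun b => ∀ x, x ∈ₘ b ↔ P x)
    ⟨b, hb, fun c hc => ext fun z => (hc z).trans (hb z).symm⟩ x

/-- `{x ∈ a | P x}`, for a definable class `P`. -/
noncomputable def sep (a : M) (P : M → Prop) : M := the fun b => ∀ x, x ∈ₘ b ↔ x ∈ₘ a ∧ P x

/-- `{F x | x ∈ a}`, for a definable class function `F`. -/
noncomputable def image (F : M → M) (a : M) : M := the fun b => ∀ y, y ∈ₘ b ↔ ∃ x, x ∈ₘ a ∧ y = F x

/-- `{x, y}`. -/
noncomputable def upair (x y : M) : M := the fun b => ∀ z, z ∈ₘ b ↔ z = x ∨ z = y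

/-- `⋃ x`. -/
noncomputable def sUnion (x : M) : M := the fun b => ∀ z, z ∈ₘ b ↔ ∃ y, y ∈ₘ x ∧ z ∈ₘ y

/-- The power set of `x`. -/
noncomputable def pow (x : M) : M := the fun b => ∀ z, z ∈ₘ b ↔ Incl z x

variable (M) in
/-- The empty set. -/
noncomputable def emp : M := the fun b => ∀ z : M, z ∈ₘ b ↔ False

/-- `a ∪ {x}`. -/
noncomputable def adj (a x : M) : M := the fun b => ∀ z, z ∈ₘ b ↔ z ∈ₘ a ∨ z = x

/-- `x ∪ {x}`. -/
noncomputable def succ (x : M) : M := adj x x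

/-- `x \ y`. -/
noncomputable def diff (x y : M) : M := sep x fun z => ¬ z ∈ₘ y

/-- The Kuratowski pair `(x, y)`. -/
noncomputable def opair (x y : M) : M := upair (upair x x) (upair x y)

/-- The first component of a pair. -/
noncomputable def fst (p : M) : M := the fun x => ∃ y, p = opair x y

/-- The second component of a pair. -/
noncomputable def snd (p : M) : M := the fun y => ∃ x, p = opair x y

/-- `A × B`. -/
noncomputable def prod (A B : M) : M := sUnion (image (fun a => image (fun b => opair a b) B) A)

/-- The set function `x ↦ F x` with domain `A`. -/
noncomputable def lam (F : M → M) (A : M) : M := image (fun x => opair x (F x)) A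

/-- The value of the set function `f` at `x`, unspecified outside the domain of `f`. -/
noncomputable def app (f x : M) : M := the fun y => opair x y ∈ₘ f

section Instances

variable (s t : (Fin n → M) → M)

instance DefMap.sep (P : (Fin n → M) → M → Prop) [DefMap s]
    [DefPred fun w : Fin (n + 1) → M => P (init w) (last w)] :
    DefMap fun v => sep (s v) (P v) := by
  unfold InZF.sep; infer_instance

instance DefMap.image (F : (Fin n → M) → M → M) [DefMap s]
    [DefMap fun w : Fin (n + 1) → M => F (init w) (last w)] :
    DefMap fun v => image (F v) (s v) := by
  unfold InZF.image; infer_instance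

instance DefMap.upair [DefMap s] [DefMap t] : DefMap fun v => upair (s v) (t v) := by
  unfold InZF.upair; infer_instance

instance DefMap.sUnion [DefMap s] : DefMap fun v => sUnion (s v) := by
  unfold InZF.sUnion; infer_instance

instance DefMap.adj [DefMap s] [DefMap t] : DefMap fun v => adj (s v) (t v) := by
  unfold InZF.adj; infer_instance

instance DefMap.succ [DefMap s] : DefMap fun v => succ (s v) := by
  unfold InZF.succ; infer_instance

instance DefMap.opair [DefMap s] [DefMap t] : DefMap fun v => opair (s v) (t v) := by
  unfold InZF.opair; infer_instance

instance DefMap.fst [DefMap s] : DefMap fun v => fst (s v) := by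
  unfold InZF.fst; infer_instance

instance DefMap.snd [DefMap s] : DefMap fun v => snd (s v) := by
  unfold InZF.snd; infer_instance

instance DefMap.prod [DefMap s] [DefMap t] : DefMap fun v => prod (s v) (t v) := by
  unfold InZF.prod; infer_instance

instance DefMap.app [DefMap s] [DefMap t] : DefMap fun v => app (s v) (t v) := by
  unfold InZF.app; infer_instance

end Instances

@[simp] theorem mem_sep {a x : M} {P : M → Prop} [h : DefPred₁ P] :
    x ∈ₘ sep a P ↔ x ∈ₘ a ∧ P x :=
  the_set_spec (hZF.out.separation {x | P x} h.out.out a) x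

@[simp] theorem mem_image {F : M → M} [h : DefMap₁ F] {a y : M} :
    y ∈ₘ image F a ↔ ∃ x, x ∈ₘ a ∧ y = F x :=
  the_set_spec (hZF.out.replacement {p | p.2 = F p.1} (h.out.out.reindex ![1, 0]).out a
    fun x _ => ⟨F x, rfl, fun _ hy => hy⟩) y

@[simp] theorem mem_upair {x y z : M} : z ∈ₘ upair x y ↔ z = x ∨ z = y :=
  the_set_spec (hZF.out.pairing x y) z

@[simp] theorem mem_sUnion {x z : M} : z ∈ₘ sUnion x ↔ ∃ y, y ∈ₘ x ∧ z ∈ₘ y :=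
  the_set_spec (hZF.out.union x) z

@[simp] theorem mem_pow {x z : M} : z ∈ₘ pow x ↔ Incl z x :=
  the_set_spec (hZF.out.powerset x) z

@[simp] theorem not_mem_emp {z : M} : ¬ z ∈ₘ emp M := fun h => by
  refine (the_set_spec (P := fun _ : M => False)
    ⟨sep (Classical.arbitrary M) fun _ => False, ?_⟩ z).1 h
  simp

@[simp] theorem mem_adj {a x z : M} : z ∈ₘ adj a x ↔ z ∈ₘ a ∨ z = x :=
  the_set_spec ⟨sUnion (upair a (upair x x)), by simp⟩ z

@[simp] theorem mem_succ {x z : M} : z ∈ₘ succ x ↔ z ∈ₘ x ∨ z = x := mem_adj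

@[simp] theorem mem_diff {x y z : M} : z ∈ₘ diff x y ↔ z ∈ₘ x ∧ ¬ z ∈ₘ y := mem_sep

theorem eq_emp {x : M} (h : ∀ z, ¬ z ∈ₘ x) : x = emp M := ext fun z => by simp [h z]

theorem upair_comm (x y : M) : upair x y = upair y x := ext fun z => by simp [or_comm]

theorem upair_inj {a b c d : M} (h : upair a b = upair c d) :
    (a = c ∧ b = d) ∨ (a = d ∧ b = c) := by
  have h1 : a = c ∨ a = d := mem_upair.1 (h ▸ mem_upair.2 (.inl rfl))
  have h2 : b = c ∨ b = d := mem_upair.1 (h ▸ mem_upair.2 (.inr rfl))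
  have h3 : c = a ∨ c = b := mem_upair.1 (h ▸ mem_upair.2 (.inl rfl))
  have h4 : d = a ∨ d = b := mem_upair.1 (h ▸ mem_upair.2 (.inr rfl))
  grind

@[simp] theorem opair_inj {x y x' y' : M} : opair x y = opair x' y' ↔ x = x' ∧ y = y' := by
  refine ⟨fun h => ?_, by rintro ⟨rfl, rfl⟩; rfl⟩
  rcases upair_inj h with ⟨h1, h2⟩ | ⟨h1, h2⟩ <;>
    rcases upair_inj h1 with h1 | h1 <;> rcases upair_inj h2 with h2 | h2 <;> grind

@[simp] theorem fst_opair (x y : M) : fst (opair x y) = x :=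
  the_eq ⟨y, rfl⟩ (by rintro z ⟨w, h⟩; exact (opair_inj.1 h).1.symm)

@[simp] theorem snd_opair (x y : M) : snd (opair x y) = y :=
  the_eq ⟨x, rfl⟩ (by rintro z ⟨w, h⟩; exact (opair_inj.1 h).2.symm)

@[simp] theorem mem_prod {A B p : M} :
    p ∈ₘ prod A B ↔ ∃ a b, a ∈ₘ A ∧ b ∈ₘ B ∧ p = opair a b := by
  unfold prod; simp

@[simp] theorem mem_lam {F : M → M} [DefMap₁ F] {A p : M} :
    p ∈ₘ lam F A ↔ ∃ x, x ∈ₘ A ∧ p = opair x (F x) := mem_image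

@[simp] theorem isEmp_iff {e : M} : IsEmp e ↔ e = emp M :=
  ⟨eq_emp, by rintro rfl z; simp⟩

@[simp] theorem isUPair_iff {p x y : M} : IsUPair p x y ↔ p = upair x y :=
  ⟨fun h => ext fun z => by simp [h z], by rintro rfl z; simp⟩

@[simp] theorem isSucc_iff {s x : M} : IsSucc s x ↔ s = succ x :=
  ⟨fun h => ext fun z => by simp [h z], by rintro rfl z; simp⟩

@[simp] theorem isOPair_iff {p x y : M} : IsOPair p x y ↔ p = opair x y := by
  simp [IsOPair, opair]

@[simp] theorem pairMem_iff {f x y : M} : PairMem f x y ↔ opair x y ∈ₘ f := by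
  simp [PairMem]

@[simp] theorem app_lam {F : M → M} [DefMap₁ F] {A x : M} (h : x ∈ₘ A) : app (lam F A) x = F x :=
  the_eq (by simp [h]) (by simp +contextual)

theorem not_mem_cycle {x y : M} (h : x ∈ₘ y) : ¬ y ∈ₘ x := fun h' => by
  obtain ⟨z, hz, hz'⟩ := hZF.out.foundation (upair x y) ⟨x, by simp⟩
  rcases mem_upair.1 hz with rfl | rfl
  · exact hz' y h' (by simp)
  · exact hz' x h (by simp)

@[simp] theorem not_mem_self (x : M) : ¬ x ∈ₘ x := fun h => not_mem_cycle h h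

/-! ### Functions and cardinality -/

theorem IsFunc.mem_iff {f A B : M} (h : IsFunc f A B) {x y : M} :
    opair x y ∈ₘ f ↔ x ∈ₘ A ∧ y = app f x := by
  have key : ∀ x, x ∈ₘ A → ∃! y, opair x y ∈ₘ f := fun x hx => by simpa using h.2 x hx
  constructor
  · intro hxy
    obtain ⟨x', y', hx', -, e⟩ := h.1 _ hxy
    obtain ⟨rfl, rfl⟩ := opair_inj.1 (isOPair_iff.1 e)
    exact ⟨hx', (key _ hx').unique hxy (the_spec (key _ hx'))⟩
  · rintro ⟨hx, rfl⟩
    exact the_spec (key x hx)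

theorem IsFunc.app_mem {f A B : M} (h : IsFunc f A B) {x : M} (hx : x ∈ₘ A) : app f x ∈ₘ B := by
  obtain ⟨x', y', -, hy, e⟩ := h.1 _ (h.mem_iff.2 ⟨hx, rfl⟩)
  exact (opair_inj.1 (isOPair_iff.1 e)).2 ▸ hy

theorem isFunc_lam {F : M → M} [DefMap₁ F] {A B : M} (h : ∀ x, x ∈ₘ A → F x ∈ₘ B) :
    IsFunc (lam F A) A B := by
  refine ⟨fun p hp => ?_, fun x hx => ⟨F x, by simp [hx], by simp +contextual⟩⟩
  obtain ⟨x, hx, rfl⟩ := mem_lam.1 hp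
  exact ⟨x, F x, hx, h x hx, by simp⟩

/-- By replacement, a definable class function restricts to a set function. -/
theorem CardLE.of_map (F : M → M) [DefMap₁ F] {A B : M} (h : ∀ x, x ∈ₘ A → F x ∈ₘ B)
    (hi : ∀ x y, x ∈ₘ A → y ∈ₘ A → F x = F y → x = y) : CardLE A B := by
  refine ⟨lam F A, isFunc_lam h, fun x y z hx hy => ?_⟩
  simp only [pairMem_iff, mem_lam, opair_inj] at hx hy
  obtain ⟨x', hx', rfl, rfl⟩ := hx
  obtain ⟨y', hy', rfl, e⟩ := hy
  exact hi _ _ hx' hy' e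

theorem CardLE.exists_map {A B : M} (h : CardLE A B) : ∃ F : M → M, DefMap₁ F ∧
    (∀ x, x ∈ₘ A → F x ∈ₘ B) ∧ ∀ x y, x ∈ₘ A → y ∈ₘ A → F x = F y → x = y := by
  obtain ⟨f, hf, hi⟩ := h
  refine ⟨app f, inferInstance, fun x hx => hf.app_mem hx, fun x y hx hy e => ?_⟩
  exact hi x y (app f x) (by simp [hf.mem_iff, hx]) (by simp [hf.mem_iff, hy, e])

theorem CardEq.of_map (F : M → M) [DefMap₁ F] {A B : M} (h : ∀ x, x ∈ₘ A → F x ∈ₘ B)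
    (hi : ∀ x y, x ∈ₘ A → y ∈ₘ A → F x = F y → x = y)
    (hs : ∀ y, y ∈ₘ B → ∃ x, x ∈ₘ A ∧ F x = y) : CardEq A B := by
  refine ⟨lam F A, isFunc_lam h, fun x y z hx hy => ?_, fun y hy => ?_⟩
  · simp only [pairMem_iff, mem_lam, opair_inj] at hx hy
    obtain ⟨x', hx', rfl, rfl⟩ := hx
    obtain ⟨y', hy', rfl, e⟩ := hy
    exact hi _ _ hx' hy' e
  · obtain ⟨x, hx, rfl⟩ := hs y hy
    exact ⟨x, by simp [hx]⟩

theorem CardEq.exists_map {A B : M} (h : CardEq A B) : ∃ F : M → M, DefMap₁ F ∧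
    (∀ x, x ∈ₘ A → F x ∈ₘ B) ∧ (∀ x y, x ∈ₘ A → y ∈ₘ A → F x = F y → x = y) ∧
    ∀ y, y ∈ₘ B → ∃ x, x ∈ₘ A ∧ F x = y := by
  obtain ⟨f, hf, hi, ho⟩ := h
  refine ⟨app f, inferInstance, fun x hx => hf.app_mem hx, fun x y hx hy e => ?_, fun y hy => ?_⟩
  · exact hi x y (app f x) (by simp [hf.mem_iff, hx]) (by simp [hf.mem_iff, hy, e])
  · obtain ⟨x, hx⟩ := ho y hy
    rw [pairMem_iff, hf.mem_iff] at hx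
    exact ⟨x, hx.1, hx.2.symm⟩

theorem CardLE.of_incl {A B : M} (h : Incl A B) : CardLE A B :=
  .of_map (fun x => x) h fun _ _ _ _ e => e

theorem CardLE.trans {A B C : M} (h : CardLE A B) (h' : CardLE B C) : CardLE A C := by
  obtain ⟨F, _, hF, hF'⟩ := h.exists_map
  obtain ⟨G, _, hG, hG'⟩ := h'.exists_map
  exact .of_map (fun x => G (F x)) (fun x hx => hG _ (hF _ hx))
    fun x y hx hy e => hF' _ _ hx hy (hG' _ _ (hF _ hx) (hF _ hy) e)

theorem CardEq.refl (A : M) : CardEq A A :=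
  .of_map (fun x => x) (fun _ h => h) (fun _ _ _ _ e => e) fun y hy => ⟨y, hy, rfl⟩

theorem CardEq.symm {A B : M} (h : CardEq A B) : CardEq B A := by
  obtain ⟨F, _, hF, hi, hs⟩ := h.exists_map
  have key : ∀ y, y ∈ₘ B → the (fun x => x ∈ₘ A ∧ F x = y) ∈ₘ A ∧
      F (the fun x => x ∈ₘ A ∧ F x = y) = y := fun y hy => by
    obtain ⟨x, hx, e⟩ := hs y hy
    exact the_spec (P := fun x => x ∈ₘ A ∧ F x = y)
      ⟨x, ⟨hx, e⟩, fun z hz => hi _ _ hz.1 hx (hz.2.trans e.symm)⟩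
  refine .of_map (fun y => the fun x => x ∈ₘ A ∧ F x = y) (fun y hy => (key y hy).1)
    (fun y z hy hz e => ?_) fun x hx => ⟨F x, hF x hx, ?_⟩
  · have := (key y hy).2; rw [e] at this; exact this.symm.trans (key z hz).2
  · exact hi _ _ (key _ (hF x hx)).1 hx (key _ (hF x hx)).2

theorem CardEq.trans {A B C : M} (h : CardEq A B) (h' : CardEq B C) : CardEq A C := by
  obtain ⟨F, _, hF, hF', hFs⟩ := h.exists_map
  obtain ⟨G, _, hG, hG', hGs⟩ := h'.exists_map
  refine .of_map (fun x => G (F x)) (fun x hx => hG _ (hF _ hx))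
    (fun x y hx hy e => hF' _ _ hx hy (hG' _ _ (hF _ hx) (hF _ hy) e)) fun z hz => ?_
  obtain ⟨y, hy, rfl⟩ := hGs z hz
  obtain ⟨x, hx, rfl⟩ := hFs y hy
  exact ⟨x, hx, rfl⟩

/-! ### Ordinals -/

omit hZF in
theorem IsOrd.incl {α x : M} (h : IsOrd α) (hx : x ∈ₘ α) : Incl x α := h.1 x hx

omit hZF in
theorem IsOrd.trans {α x y : M} (h : IsOrd α) (hx : x ∈ₘ α) (hy : y ∈ₘ x) : y ∈ₘ α := h.1 x hx y hy

theorem IsOrd.mem {α x : M} (h : IsOrd α) (hx : x ∈ₘ α) : IsOrd x := by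
  refine ⟨fun y hy z hz => ?_, fun y z hy hz => h.2 y z (h.trans hx hy) (h.trans hx hz)⟩
  have hy' := h.trans hx hy
  rcases h.2 z x (h.trans hy' hz) hx with h1 | rfl | h1
  · exact h1
  · exact absurd hy (not_mem_cycle hz)
  · -- otherwise `x ∈ z ∈ y ∈ x` contradicts foundation
    exfalso
    obtain ⟨w, hw, hw'⟩ := hZF.out.foundation (adj (upair x y) z) ⟨x, by simp⟩
    simp only [mem_adj, mem_upair] at hw hw'
    rcases hw with (rfl | rfl) | rfl
    · exact hw' y hy (by simp)
    · exact hw' z hz (by simp)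
    · exact hw' x h1 (by simp)

/-- A transitive proper subset of an ordinal is an element of it. -/
theorem IsOrd.mem_of_incl {α t : M} (h : IsOrd α) (ht : Incl t α)
    (htr : ∀ x, x ∈ₘ t → Incl x t) (hne : t ≠ α) : t ∈ₘ α := by
  have hd : ∃ y, y ∈ₘ diff α t := by
    by_contra hd
    push Not at hd
    exact hne (ht.antisymm fun z hz => by simpa [hz] using hd z)
  obtain ⟨m, hm, hm'⟩ := hZF.out.foundation _ hd
  rw [mem_diff] at hm
  have : t = m := by
    refine ext fun z => ⟨fun hz => ?_, fun hz => ?_⟩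
    · rcases h.2 z m (ht z hz) hm.1 with h1 | rfl | h1
      · exact h1
      · exact absurd hz hm.2
      · exact absurd (htr z hz m h1) hm.2
    · by_contra hzt
      exact hm' z hz (mem_diff.2 ⟨h.trans hm.1 hz, hzt⟩)
  rw [this]; exact hm.1

theorem IsOrd.mem_of_incl_of_ne {α β : M} (hα : IsOrd α) (hβ : IsOrd β) (h : Incl β α)
    (hne : β ≠ α) : β ∈ₘ α :=
  hα.mem_of_incl h (fun _ hx => hβ.incl hx) hne

theorem IsOrd.trichotomy {α β : M} (hα : IsOrd α) (hβ : IsOrd β) : α ∈ₘ β ∨ α = β ∨ β ∈ₘ α := by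
  set γ := sep α fun x => x ∈ₘ β with hγ
  have h1 : Incl γ α := fun x hx => (mem_sep.1 hx).1
  have h2 : Incl γ β := fun x hx => (mem_sep.1 hx).2
  have ht : ∀ x, x ∈ₘ γ → Incl x γ := fun x hx y hy =>
    mem_sep.2 ⟨hα.trans (h1 x hx) hy, hβ.trans (h2 x hx) hy⟩
  by_cases e1 : γ = α
  · by_cases e2 : γ = β
    · exact .inr (.inl (e1.symm.trans e2))
    · exact .inl (e1 ▸ hβ.mem_of_incl h2 ht e2)
  · by_cases e2 : γ = β
    · exact .inr (.inr (e2 ▸ hα.mem_of_incl h1 ht e1))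
    · exact absurd (mem_sep.2 ⟨hα.mem_of_incl h1 ht e1, hβ.mem_of_incl h2 ht e2⟩ : γ ∈ₘ γ)
        (not_mem_self γ)

theorem IsOrd.incl_of_not_mem {α β : M} (hα : IsOrd α) (hβ : IsOrd β) (h : ¬ α ∈ₘ β) :
    Incl β α := by
  rcases hα.trichotomy hβ with h1 | rfl | h1
  · exact absurd h1 h
  · exact .refl _
  · exact hα.incl h1

theorem IsOrd.mem_succ_of_incl {α β : M} (hα : IsOrd α) (hβ : IsOrd β) (h : Incl α β) :
    α ∈ₘ succ β := by
  rw [mem_succ, or_iff_not_imp_right]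
  exact hβ.mem_of_incl_of_ne hα h

/-- A definable property of some ordinal has a least instance. -/
theorem IsOrd.exists_least (P : M → Prop) [DefPred₁ P] {α : M} (hα : IsOrd α) (h : P α) :
    ∃ β, IsOrd β ∧ P β ∧ ∀ γ, γ ∈ₘ β → ¬ P γ := by
  obtain ⟨β, hβ, hβ'⟩ := hZF.out.foundation (sep (succ α) P) ⟨α, by simp [h]⟩
  rw [mem_sep, mem_succ] at hβ
  have ho : IsOrd β := by
    rcases hβ.1 with h1 | rfl
    · exact hα.mem h1
    · exact hα
  refine ⟨β, ho, hβ.2, fun γ hγ hP => hβ' γ hγ (mem_sep.2 ⟨mem_succ.2 ?_, hP⟩)⟩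
  rcases hβ.1 with h1 | rfl
  · exact .inl (hα.trans h1 hγ)
  · exact .inl hγ

theorem IsOrd.induction (P : M → Prop) [DefPred₁ P]
    (ih : ∀ α, IsOrd α → (∀ β, β ∈ₘ α → P β) → P α) {α : M} (hα : IsOrd α) : P α := by
  by_contra h
  obtain ⟨β, hβ, h1, h2⟩ := hα.exists_least (fun x => ¬ P x) h
  exact h1 (ih β hβ fun γ hγ => by simpa using h2 γ hγ)

theorem isOrd_of_forall {α : M} (ht : ∀ x, x ∈ₘ α → Incl x α) (h : ∀ x, x ∈ₘ α → IsOrd x) :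
    IsOrd α :=
  ⟨ht, fun x y hx hy => (h x hx).trichotomy (h y hy)⟩

theorem isOrd_emp : IsOrd (emp M) := ⟨by simp, by simp⟩

theorem IsOrd.succ {α : M} (h : IsOrd α) : IsOrd (succ α) := by
  refine isOrd_of_forall (fun x hx y hy => ?_) fun x hx => ?_
  · rcases mem_succ.1 hx with h1 | rfl
    · exact mem_succ.2 (.inl (h.trans h1 hy))
    · exact mem_succ.2 (.inl hy)
  · rcases mem_succ.1 hx with h1 | rfl
    exacts [h.mem h1, h]

/-- The least element of a nonempty set of ordinals. -/
noncomputable def least (a : M) : M := the fun x => x ∈ₘ a ∧ ∀ y, y ∈ₘ a → x ∈ₘ y ∨ x = y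

instance DefMap.least (s : (Fin n → M) → M) [DefMap s] : DefMap fun v => least (s v) := by
  unfold InZF.least; infer_instance

theorem least_spec {a : M} (ha : ∀ x, x ∈ₘ a → IsOrd x) (hne : ∃ x, x ∈ₘ a) :
    least a ∈ₘ a ∧ ∀ y, y ∈ₘ a → least a ∈ₘ y ∨ least a = y := by
  obtain ⟨m, hm, hm'⟩ := hZF.out.foundation a hne
  have hmin : ∀ y, y ∈ₘ a → m ∈ₘ y ∨ m = y := fun y hy => by
    rcases (ha m hm).trichotomy (ha y hy) with h | h | h
    exacts [.inl h, .inr h, absurd hy (hm' y h)]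
  refine the_spec (P := fun x => x ∈ₘ a ∧ ∀ y, y ∈ₘ a → x ∈ₘ y ∨ x = y) ⟨m, ⟨hm, hmin⟩, ?_⟩
  rintro y ⟨hy, hy'⟩
  rcases hy' m hm with h | h
  · exact absurd hy (hm' y h)
  · exact h

/-! ### Natural numbers and finite sets -/

theorem isNat_emp : IsNat (emp M) := ⟨isOrd_emp, by simp⟩

theorem IsNat.succ {k : M} (h : IsNat k) : IsNat (succ k) := by
  refine ⟨h.1.succ, fun m hm => ?_⟩
  rcases hm with hm | rfl
  · exact h.2 m (mem_succ.1 hm)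
  · exact .inr ⟨k, isSucc_iff.2 rfl⟩

theorem IsNat.mem {k m : M} (h : IsNat k) (hm : m ∈ₘ k) : IsNat m := by
  refine ⟨h.1.mem hm, fun l hl => h.2 l (.inl ?_)⟩
  rcases hl with hl | rfl
  exacts [h.1.trans hm hl, hm]

theorem IsNat.cases {k : M} (h : IsNat k) : k = emp M ∨ ∃ m, IsNat m ∧ k = InZF.succ m := by
  rcases h.2 k (.inr rfl) with h1 | ⟨m, hm⟩
  · exact .inl (isEmp_iff.1 h1)
  · rw [isSucc_iff] at hm
    exact .inr ⟨m, h.mem (by simp [hm]), hm⟩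

theorem IsNat.induction (P : M → Prop) [DefPred₁ P] (h0 : P (emp M))
    (hs : ∀ k, IsNat k → P k → P (InZF.succ k)) {k : M} (hk : IsNat k) : P k := by
  refine IsOrd.induction (fun k => IsNat k → P k) (fun α _ ih hα => ?_) hk.1 hk
  rcases hα.cases with rfl | ⟨m, hm, rfl⟩
  · exact h0
  · exact hs m hm (ih m (by simp) hm)

variable (M) in
/-- The set of natural numbers. -/
noncomputable def omega : M := the fun w => ∀ k : M, k ∈ₘ w ↔ IsNat k

@[simp] theorem mem_omega {k : M} : k ∈ₘ omega M ↔ IsNat k := by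
  refine the_set_spec ?_ k
  obtain ⟨w, ⟨e, he, hew⟩, hw⟩ := hZF.out.infinity
  obtain rfl := isEmp_iff.1 he
  refine ⟨sep w IsNat, fun k => ?_⟩
  rw [mem_sep, and_iff_right_iff_imp]
  refine IsNat.induction (fun k => k ∈ₘ w) hew fun k _ hk => ?_
  obtain ⟨s, hs, hsw⟩ := hw k hk
  rwa [isSucc_iff.1 hs] at hsw

theorem isOrd_omega : IsOrd (omega M) :=
  isOrd_of_forall (fun _ hx _ hy => mem_omega.2 ((mem_omega.1 hx).mem hy))
    fun _ hx => (mem_omega.1 hx).1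

theorem IsNat.isFin {k : M} (h : IsNat k) : IsFin k := ⟨k, h, .refl k⟩

/-! ### Well-founded recursion and order types -/

theorem image_congr {F G : M → M} [DefMap₁ F] [DefMap₁ G] {a : M}
    (h : ∀ x, x ∈ₘ a → F x = G x) : image F a = image G a :=
  ext fun y => by
    simp only [mem_image]
    exact exists_congr fun x => and_congr_right fun hx => by rw [h x hx]

/-- The solution `F` of the recursion `F x = G x {F y | y ∈ pred x}`, where `pred x` is the set of
predecessors of `x` in a transitive well-founded relation. Its value at `x` is read off from any
set function that satisfies the recursion on `pred x ∪ {x}`. -/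
noncomputable def wfRec (pred : M → M) (G : M → M → M) (x : M) : M :=
  the fun v => ∃ f, (∀ y, y ∈ₘ adj (pred x) x → app f y = G y (image (fun z => app f z) (pred y))) ∧
    v = app f x

instance DefMap.wfRec (pred : (Fin n → M) → M → M) (G : (Fin n → M) → M → M → M)
    (t : (Fin n → M) → M) [DefMap fun w : Fin (n + 1) → M => pred (init w) (last w)]
    [DefMap fun w : Fin (n + 1 + 1) → M => G (init (init w)) (last (init w)) (last w)] [DefMap t] :
    DefMap fun v => wfRec (pred v) (G v) (t v) := by
  unfold InZF.wfRec; infer_instance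

/-- `pred` gives the predecessors in a transitive well-founded relation on the set `W`. -/
structure WFOn (W : M) (pred : M → M) : Prop where
  incl : ∀ x, x ∈ₘ W → Incl (pred x) W
  trans : ∀ x, x ∈ₘ W → ∀ y, y ∈ₘ pred x → Incl (pred y) (pred x)
  wf : ∀ a, Incl a W → (∃ x, x ∈ₘ a) → ∃ x, x ∈ₘ a ∧ ∀ y, y ∈ₘ a → ¬ y ∈ₘ pred x

namespace WFOn

variable {W : M} {pred : M → M}

theorem induction (h : WFOn W pred) (P : M → Prop) [DefPred₁ P]
    (ih : ∀ x, x ∈ₘ W → (∀ y, y ∈ₘ pred x → P y) → P x) {x : M} (hx : x ∈ₘ W) : P x := by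
  by_contra hP
  obtain ⟨y, hy, hy'⟩ := h.wf (sep W fun x => ¬ P x) (fun z hz => (mem_sep.1 hz).1)
    ⟨x, mem_sep.2 ⟨hx, hP⟩⟩
  rw [mem_sep] at hy
  exact hy.2 (ih y hy.1 fun z hz => by
    by_contra hPz
    exact hy' z (mem_sep.2 ⟨h.incl y hy.1 z hz, hPz⟩) hz)

variable [DefMap₁ pred]

theorem wfRec_eq (h : WFOn W pred) (G : M → M → M) [DefMap₂ G] {x : M} (hx : x ∈ₘ W) :
    wfRec pred G x = G x (image (wfRec pred G) (pred x)) := by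
  refine h.induction (fun x => wfRec pred G x = G x (image (fun y => wfRec pred G y) (pred x)))
    (fun x hx ih => ?_) hx
  set f := lam (fun y => G y (image (fun z => wfRec pred G z) (pred y))) (adj (pred x) x) with hf
  have happ : ∀ y, y ∈ₘ adj (pred x) x →
      app f y = G y (image (fun z => wfRec pred G z) (pred y)) := fun y hy => app_lam hy
  have hsub : ∀ y, y ∈ₘ adj (pred x) x → Incl (pred y) (pred x) := fun y hy => by
    rcases mem_adj.1 hy with hy | rfl
    exacts [h.trans x hx y hy, .refl _]
  have hfa : ∀ y, y ∈ₘ adj (pred x) x → app f y = G y (image (fun z => app f z) (pred y)) :=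
    fun y hy => by
      rw [happ y hy]
      congr 1
      refine image_congr fun z hz => ?_
      have hz' := hsub y hy z hz
      rw [happ z (mem_adj.2 (.inl hz')), ih z hz']
  have : wfRec pred G x = app f x := by
    refine the_eq ⟨f, hfa, rfl⟩ ?_
    rintro v ⟨g, hg, rfl⟩
    refine h.induction (fun y => y ∈ₘ adj (pred x) x → app g y = app f y)
      (fun y _ ihy hy => ?_) hx (by simp)
    rw [hg y hy, hfa y hy]
    congr 1
    exact image_congr fun z hz => ihy z hz (mem_adj.2 (.inl (hsub y hy z hz)))
  rw [this, happ x (by simp)]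

end WFOn

theorem IsOrd.wfOn {α : M} (h : IsOrd α) : WFOn α fun x => x :=
  ⟨fun _ hx => h.incl hx, fun _ hx _ hy => (h.mem hx).incl hy, fun a _ hne => by
    obtain ⟨x, hx, hx'⟩ := hZF.out.foundation a hne
    exact ⟨x, hx, fun y hy hyx => hx' y hyx hy⟩⟩

/-- The Mostowski collapse of the relation with predecessors `pred`. -/
noncomputable def collapse (pred : M → M) (x : M) : M := wfRec pred (fun _ s => s) x

instance DefMap.collapse (pred : (Fin n → M) → M → M) (t : (Fin n → M) → M)
    [DefMap fun w : Fin (n + 1) → M => pred (init w) (last w)] [DefMap t] :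
    DefMap fun v => collapse (pred v) (t v) := by
  unfold InZF.collapse; infer_instance

namespace WFOn

variable {W : M} {pred : M → M} [DefMap₁ pred]

theorem mem_collapse (h : WFOn W pred) {x z : M} (hx : x ∈ₘ W) :
    z ∈ₘ collapse pred x ↔ ∃ y, y ∈ₘ pred x ∧ z = collapse pred y := by
  have : collapse pred x = image (fun y => collapse pred y) (pred x) := h.wfRec_eq _ hx
  rw [this, mem_image]

theorem isOrd_collapse (h : WFOn W pred)
    (ht : ∀ x y, x ∈ₘ W → y ∈ₘ W → x ∈ₘ pred y ∨ x = y ∨ y ∈ₘ pred x) {x : M} (hx : x ∈ₘ W) :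
    IsOrd (collapse pred x) := by
  refine ⟨fun y' hy' z' hz' => ?_, fun y' z' hy' hz' => ?_⟩
  · obtain ⟨y, hy, rfl⟩ := (h.mem_collapse hx).1 hy'
    obtain ⟨z, hz, rfl⟩ := (h.mem_collapse (h.incl x hx y hy)).1 hz'
    exact (h.mem_collapse hx).2 ⟨z, h.trans x hx y hy z hz, rfl⟩
  · obtain ⟨y, hy, rfl⟩ := (h.mem_collapse hx).1 hy'
    obtain ⟨z, hz, rfl⟩ := (h.mem_collapse hx).1 hz'
    have hyW := h.incl x hx y hy
    have hzW := h.incl x hx z hz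
    rcases ht y z hyW hzW with h1 | rfl | h1
    · exact .inl ((h.mem_collapse hzW).2 ⟨y, h1, rfl⟩)
    · exact .inr (.inl rfl)
    · exact .inr (.inr ((h.mem_collapse hyW).2 ⟨z, h1, rfl⟩))

theorem collapse_inj (h : WFOn W pred)
    (ht : ∀ x y, x ∈ₘ W → y ∈ₘ W → x ∈ₘ pred y ∨ x = y ∨ y ∈ₘ pred x) {x y : M} (hx : x ∈ₘ W)
    (hy : y ∈ₘ W) (e : collapse pred x = collapse pred y) : x = y := by
  rcases ht x y hx hy with h1 | h1 | h1
  · have := (h.mem_collapse hy).2 ⟨x, h1, rfl⟩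
    rw [e] at this; exact absurd this (not_mem_self _)
  · exact h1
  · have := (h.mem_collapse hx).2 ⟨y, h1, rfl⟩
    rw [e] at this; exact absurd this (not_mem_self _)

/-- In a well-ordering where some point has rank at least `κ`, the predecessors of that point
contain a copy of `κ`. -/
theorem cardLE_pred (h : WFOn W pred)
    (ht : ∀ x y, x ∈ₘ W → y ∈ₘ W → x ∈ₘ pred y ∨ x = y ∨ y ∈ₘ pred x) {x κ : M} (hx : x ∈ₘ W)
    (hκ : IsOrd κ) (hle : ¬ collapse pred x ∈ₘ κ) : CardLE κ (pred x) := by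
  refine (CardLE.of_incl ((h.isOrd_collapse ht hx).incl_of_not_mem hκ hle)).trans
    (CardEq.cardLE (.symm (.of_map (fun y => collapse pred y) (fun y hy => ?_) ?_ ?_)))
  · exact (h.mem_collapse hx).2 ⟨y, hy, rfl⟩
  · exact fun y z hy hz e => h.collapse_inj ht (h.incl x hx y hy) (h.incl x hx z hz) e
  · intro z hz
    obtain ⟨y, hy, rfl⟩ := (h.mem_collapse hx).1 hz
    exact ⟨y, hy, rfl⟩

end WFOn

/-- The order type of `{y ∈ S | y < x}`, for a set `S` of ordinals and `x ∈ S`. -/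
noncomputable def rk (S x : M) : M := collapse (fun y => sep S fun z => z ∈ₘ y) x

instance DefMap.rk (s t : (Fin n → M) → M) [DefMap s] [DefMap t] :
    DefMap fun v => rk (s v) (t v) := by
  unfold InZF.rk; infer_instance

section Rank

variable {S : M} (hS : ∀ x, x ∈ₘ S → IsOrd x)
include hS

theorem wfOn_of_isOrd : WFOn S fun y => sep S fun z => z ∈ₘ y := by
  refine ⟨fun x _ y hy => (mem_sep.1 hy).1, fun x hx y hy z hz => ?_, fun a ha hne => ?_⟩
  · simp only [mem_sep] at hy hz ⊢
    exact ⟨hz.1, (hS x hx).trans hy.2 hz.2⟩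
  · obtain ⟨x, hx, hx'⟩ := hZF.out.foundation a hne
    exact ⟨x, hx, fun y hy hyx => hx' y (mem_sep.1 hyx).2 hy⟩

theorem total_of_isOrd (x y : M) (hx : x ∈ₘ S) (hy : y ∈ₘ S) :
    x ∈ₘ (sep S fun z => z ∈ₘ y) ∨ x = y ∨ y ∈ₘ (sep S fun z => z ∈ₘ x) := by
  simpa [hx, hy] using (hS x hx).trichotomy (hS y hy)

theorem mem_rk {x z : M} (hx : x ∈ₘ S) : z ∈ₘ rk S x ↔ ∃ y, y ∈ₘ S ∧ y ∈ₘ x ∧ z = rk S y := by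
  unfold rk
  rw [(wfOn_of_isOrd hS).mem_collapse hx]
  simp [and_assoc]

theorem isOrd_rk {x : M} (hx : x ∈ₘ S) : IsOrd (rk S x) :=
  (wfOn_of_isOrd hS).isOrd_collapse (total_of_isOrd hS) hx

theorem rk_inj {x y : M} (hx : x ∈ₘ S) (hy : y ∈ₘ S) (e : rk S x = rk S y) : x = y :=
  (wfOn_of_isOrd hS).collapse_inj (total_of_isOrd hS) hx hy e

theorem rk_mem_rk {x y : M} (hx : x ∈ₘ S) (hy : y ∈ₘ S) : rk S x ∈ₘ rk S y ↔ x ∈ₘ y := by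
  rw [mem_rk hS hy]
  constructor
  · rintro ⟨z, hz, hzy, e⟩
    rwa [rk_inj hS hx hz e]
  · exact fun h => ⟨x, hx, h, rfl⟩

theorem rk_incl {x : M} (hx : x ∈ₘ S) : Incl (rk S x) x := by
  refine (wfOn_of_isOrd hS).induction (fun x => Incl (rk S x) x) (fun x hx ih z hz => ?_) hx
  obtain ⟨y, hy, hyx, rfl⟩ := (mem_rk hS hx).1 hz
  have h1 := (isOrd_rk hS hy).mem_succ_of_incl (hS y hy) (ih y (mem_sep.2 ⟨hy, hyx⟩))
  rcases mem_succ.1 h1 with h1 | h1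
  · exact (hS x hx).trans hyx h1
  · rwa [h1]

/-- A set of ordinals without a subset of order type `κ` is ranked into `κ`. -/
theorem exists_hasOrderType {κ x : M} (hκ : IsOrd κ) (hx : x ∈ₘ S) (h : ¬ rk S x ∈ₘ κ) :
    ∃ H, Incl H S ∧ HasOrderType H κ ∧ CardEq H κ := by
  have hle := (isOrd_rk hS hx).incl_of_not_mem hκ h
  set H := sep S fun y => rk S y ∈ₘ κ with hH
  have hHS : ∀ y, y ∈ₘ H → y ∈ₘ S := fun y hy => (mem_sep.1 hy).1
  have hsurj : ∀ α, α ∈ₘ κ → ∃ y, y ∈ₘ H ∧ rk S y = α := fun α hα => by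
    obtain ⟨y, hy, -, rfl⟩ := (mem_rk hS hx).1 (hle α hα)
    exact ⟨y, mem_sep.2 ⟨hy, hα⟩, rfl⟩
  have hinj : ∀ y z, y ∈ₘ H → z ∈ₘ H → rk S y = rk S z → y = z :=
    fun y z hy hz e => rk_inj hS (hHS y hy) (hHS z hz) e
  have key : ∀ α, α ∈ₘ κ → the (fun y => y ∈ₘ H ∧ rk S y = α) ∈ₘ H ∧
      rk S (the fun y => y ∈ₘ H ∧ rk S y = α) = α := fun α hα => by
    obtain ⟨y, hy, e⟩ := hsurj α hα
    exact the_spec (P := fun y => y ∈ₘ H ∧ rk S y = α)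
      ⟨y, ⟨hy, e⟩, fun z hz => hinj _ _ hz.1 hy (hz.2.trans e.symm)⟩
  refine ⟨H, hHS, ⟨lam (fun α => the fun y => y ∈ₘ H ∧ rk S y = α) κ,
    isFunc_lam fun α hα => (key α hα).1, fun y hy => ?_, fun α β y z hy hz hαβ => ?_⟩, ?_⟩
  · have hα := (mem_sep.1 hy).2
    refine ⟨rk S y, ?_⟩
    simp only [pairMem_iff, mem_lam, opair_inj]
    exact ⟨_, hα, rfl, (hinj _ _ (key _ hα).1 hy (key _ hα).2).symm⟩
  · simp only [pairMem_iff, mem_lam, opair_inj] at hy hz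
    obtain ⟨α, hα, rfl, rfl⟩ := hy
    obtain ⟨β, hβ, rfl, rfl⟩ := hz
    rwa [← rk_mem_rk hS (hHS _ (key α hα).1) (hHS _ (key β hβ).1), (key α hα).2, (key β hβ).2]
  · exact .of_map (fun y => rk S y) (fun y hy => (mem_sep.1 hy).2) hinj hsurj

end Rank

/-- A set of ordinals is equinumerous with an ordinal, its order type; a subset of an ordinal `α`
has order type at most `α`. -/
theorem exists_cardEq_isOrd {S α : M} (hα : IsOrd α) (hS : Incl S α) :
    ∃ β, β ∈ₘ succ α ∧ CardEq S β := by
  have hS' : ∀ x, x ∈ₘ S → IsOrd x := fun x hx => hα.mem (hS x hx)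
  have hβ : IsOrd (image (fun x => rk S x) S) := by
    refine isOrd_of_forall (fun x' hx' y' hy' => ?_) fun x' hx' => ?_
    · obtain ⟨x, hx, rfl⟩ := mem_image.1 hx'
      obtain ⟨y, hy, -, rfl⟩ := (mem_rk hS' hx).1 hy'
      exact mem_image.2 ⟨y, hy, rfl⟩
    · obtain ⟨x, hx, rfl⟩ := mem_image.1 hx'
      exact isOrd_rk hS' hx
  refine ⟨_, hβ.mem_succ_of_incl hα fun y hy => ?_,
    .of_map (fun x => rk S x) (fun x hx => mem_image.2 ⟨x, hx, rfl⟩)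
      (fun x y hx hy e => rk_inj hS' hx hy e) fun y hy => ?_⟩
  · obtain ⟨x, hx, rfl⟩ := mem_image.1 hy
    rcases mem_succ.1 ((isOrd_rk hS' hx).mem_succ_of_incl (hS' x hx) (rk_incl hS' hx)) with h | h
    · exact hα.trans (hS x hx) h
    · rw [h]; exact hS x hx
  · obtain ⟨x, hx, rfl⟩ := mem_image.1 hy
    exact ⟨x, hx, rfl⟩

theorem CardLE.exists_cardEq {A α : M} (h : CardLE A α) (hα : IsOrd α) :
    ∃ β, β ∈ₘ succ α ∧ CardEq A β := by
  obtain ⟨F, _, hF, hi⟩ := h.exists_map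
  obtain ⟨β, hβ, e⟩ := exists_cardEq_isOrd (S := image F A) hα fun y hy => by
    obtain ⟨x, hx, rfl⟩ := mem_image.1 hy
    exact hF x hx
  exact ⟨β, hβ, CardEq.trans (.of_map F (fun x hx => mem_image.2 ⟨x, hx, rfl⟩) hi
    fun y hy => by obtain ⟨x, hx, rfl⟩ := mem_image.1 hy; exact ⟨x, hx, rfl⟩) e⟩

/-- The range of an injection of `κ` into `α < κ` would have an order type at most `α`. -/
theorem IsCard.not_cardLE {κ α : M} (h : IsCard κ) (hα : α ∈ₘ κ) : ¬ CardLE κ α := fun hle => by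
  obtain ⟨β, hβ, e⟩ := hle.exists_cardEq (h.1.mem hα)
  refine h.2 β ?_ e.symm
  rcases mem_succ.1 hβ with h1 | rfl
  exacts [h.1.trans hα h1, hα]

/-! ### Finite sets -/

theorem isFin_emp : IsFin (emp M) := isNat_emp.isFin

theorem IsFin.of_cardLE {a b : M} (hb : IsFin b) (h : CardLE a b) : IsFin a := by
  obtain ⟨k, hk, e⟩ := hb
  obtain ⟨β, hβ, e'⟩ := (h.trans e.cardLE).exists_cardEq hk.1
  exact ⟨β, hk.succ.mem hβ, e'⟩

theorem IsFin.adj {a : M} (h : IsFin a) (x : M) : IsFin (adj a x) := by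
  by_cases hx : x ∈ₘ a
  · have : InZF.adj a x = a := ext fun z => by simp; rintro rfl; exact hx
    rwa [this]
  obtain ⟨k, hk, e⟩ := h
  obtain ⟨F, _, hF, hi, -⟩ := e.exists_map
  refine hk.succ.isFin.of_cardLE ?_
  classical
  refine .of_map (fun z => if z = x then k else F z) (fun z hz => ?_) fun y z hy hz => ?_
  · by_cases hzx : z = x
    · simp [hzx]
    · simp only [hzx, if_false, mem_succ]
      exact .inl (hF z (by simpa [hzx] using hz))
  · simp only [mem_adj] at hy hz
    have hk : ∀ y, y ∈ₘ a → F y ≠ k := fun y hy e => not_mem_self k (e ▸ hF y hy : k ∈ₘ k)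
    by_cases h1 : y = x <;> by_cases h2 : z = x <;> simp only [h1, h2, if_true, if_false]
    · exact fun _ => trivial
    · exact fun e => absurd e.symm (hk z (by simpa [h2] using hz))
    · exact fun e => absurd e (hk y (by simpa [h1] using hy))
    · exact hi y z (by simpa [h1] using hy) (by simpa [h2] using hz)

theorem IsFin.induction (P : M → Prop) [DefPred₁ P] (h0 : P (emp M))
    (hs : ∀ a x, IsFin a → P a → P (InZF.adj a x)) {a : M} (ha : IsFin a) : P a := by
  obtain ⟨k, hk, e⟩ := ha
  refine IsNat.induction (fun k => ∀ a, CardEq a k → P a) ?_ ?_ hk a e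
  · intro a e
    obtain ⟨F, _, hF, -⟩ := e.exists_map
    rwa [eq_emp fun z hz => not_mem_emp (hF z hz)]
  · intro k hk ih a e
    obtain ⟨F, _, hF, hi, ho⟩ := e.exists_map
    obtain ⟨x, hx, hxk⟩ := ho k (by simp)
    have hb : CardEq (sep a fun z => z ≠ x) k := by
      refine .of_map F (fun z hz => ?_) (fun y z hy hz => ?_) fun y hy => ?_
      · rw [mem_sep] at hz
        rcases mem_succ.1 (hF z hz.1) with h | h
        · exact h
        · exact absurd (hi _ _ hz.1 hx (h.trans hxk.symm)) hz.2
      · exact hi y z (mem_sep.1 hy).1 (mem_sep.1 hz).1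
      · obtain ⟨z, hz, rfl⟩ := ho y (by simp [hy])
        refine ⟨z, mem_sep.2 ⟨hz, ?_⟩, rfl⟩
        rintro rfl
        exact not_mem_self k (hxk ▸ hy)
    have : a = InZF.adj (sep a fun z => z ≠ x) x := ext fun z => by
      by_cases h : z = x <;> simp [h, hx]
    rw [this]
    exact hs _ x ⟨k, hk, hb⟩ (ih _ hb)

theorem IsFin.union {a b : M} (ha : IsFin a) (hb : IsFin b) : IsFin (sUnion (upair a b)) := by
  refine IsFin.induction (fun b => IsFin (sUnion (upair a b))) ?_ (fun b x _ ih => ?_) hb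
  · rwa [show sUnion (upair a (emp M)) = a from ext fun z => by simp]
  · rw [show sUnion (upair a (InZF.adj b x)) = InZF.adj (sUnion (upair a b)) x from
      ext fun z => by simp [or_assoc]]
    exact ih.adj x

theorem IsFin.prod {a b : M} (ha : IsFin a) (hb : IsFin b) : IsFin (prod a b) := by
  refine IsFin.induction (fun a => IsFin (InZF.prod a b)) ?_ (fun a x _ ih => ?_) ha
  · rw [show InZF.prod (emp M) b = emp M from eq_emp fun z hz => by simp at hz]
    exact isFin_emp
  · have h1 : IsFin (image (fun y => opair x y) b) := by
      refine hb.of_cardLE (.of_map snd (fun z hz => ?_) fun y z hy hz => ?_)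
      · obtain ⟨y, hy, rfl⟩ := mem_image.1 hz
        simpa
      · obtain ⟨y, -, rfl⟩ := mem_image.1 hy
        obtain ⟨z, -, rfl⟩ := mem_image.1 hz
        simp
    refine (ih.union h1).of_cardLE (.of_incl fun z hz => ?_)
    obtain ⟨c, d, hc, hd, rfl⟩ := mem_prod.1 hz
    rcases mem_adj.1 hc with hc | rfl
    · exact mem_sUnion.2 ⟨_, mem_upair.2 (.inl rfl), mem_prod.2 ⟨c, d, hc, hd, rfl⟩⟩
    · exact mem_sUnion.2 ⟨_, mem_upair.2 (.inr rfl), mem_image.2 ⟨d, hd, rfl⟩⟩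

/-- A nonempty family of subsets of a finite set has a maximal element. -/
theorem IsFin.exists_maximal {a Z : M} (ha : IsFin a) (hZ : ∀ z, z ∈ₘ Z → Incl z a)
    (hne : ∃ z, z ∈ₘ Z) : ∃ z, z ∈ₘ Z ∧ ∀ w, w ∈ₘ Z → Incl z w → w = z := by
  refine IsFin.induction (fun a => ∀ Z, (∀ z, z ∈ₘ Z → Incl z a) → (∃ z, z ∈ₘ Z) →
    ∃ z, z ∈ₘ Z ∧ ∀ w, w ∈ₘ Z → Incl z w → w = z) ?_ (fun a x _ ih Z hZ hne => ?_) ha Z hZ hne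
  · rintro Z hZ ⟨z, hz⟩
    have : ∀ w, w ∈ₘ Z → w = emp M := fun w hw => eq_emp fun y hy => not_mem_emp (hZ w hw y hy)
    exact ⟨z, hz, fun w hw _ => (this w hw).trans (this z hz).symm⟩
  · by_cases hx : ∃ z, z ∈ₘ Z ∧ x ∈ₘ z
    · -- the members containing `x`, with `x` removed, are subsets of `a`
      obtain ⟨z₀, hz₀, hxz₀⟩ := hx
      obtain ⟨y, hy, hmax⟩ := ih (image (fun z => sep z fun u => u ≠ x) (sep Z fun z => x ∈ₘ z))
        (fun y hy u hu => by
          obtain ⟨z, hz, rfl⟩ := mem_image.1 hy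
          rw [mem_sep] at hz hu
          simpa [hu.2] using hZ z hz.1 u hu.1)
        ⟨_, mem_image.2 ⟨z₀, mem_sep.2 ⟨hz₀, hxz₀⟩, rfl⟩⟩
      obtain ⟨z, hz, rfl⟩ := mem_image.1 hy
      rw [mem_sep] at hz
      refine ⟨z, hz.1, fun w hw hzw => ?_⟩
      have h1 := hmax (sep w fun u => u ≠ x)
        (mem_image.2 ⟨w, mem_sep.2 ⟨hw, hzw x hz.2⟩, rfl⟩) fun u hu => by
          rw [mem_sep] at hu ⊢
          exact ⟨hzw u hu.1, hu.2⟩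
      refine Incl.antisymm (fun u hu => ?_) hzw
      by_cases hux : u = x
      · rw [hux]; exact hz.2
      · have : u ∈ₘ sep w fun u => u ≠ x := mem_sep.2 ⟨hu, hux⟩
        rw [h1] at this
        exact (mem_sep.1 this).1
    · push Not at hx
      refine ih Z (fun z hz u hu => ?_) hne
      rcases mem_adj.1 (hZ z hz u hu) with h | rfl
      · exact h
      · exact absurd hu (hx z hz)

/-! ### Infinite cardinals -/

namespace IsInfCard

variable {κ : M} (hκ : IsInfCard κ)
include hκ

omit hZF in
theorem isOrd : IsOrd κ := hκ.1.1

theorem omega_incl : Incl (omega M) κ :=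
  hκ.isOrd.incl_of_not_mem isOrd_omega fun h => hκ.2 (mem_omega.1 h).isFin

theorem not_isFin {A : M} (h : CardLE κ A) : ¬ IsFin A := fun hA => hκ.2 (hA.of_cardLE h)

theorem emp_mem : emp M ∈ₘ κ := hκ.omega_incl _ (mem_omega.2 isNat_emp)

theorem succ_mem {α : M} (hα : α ∈ₘ κ) : succ α ∈ₘ κ := by
  have hαo := hκ.isOrd.mem hα
  by_cases hfin : IsNat α
  · exact hκ.omega_incl _ (mem_omega.2 hfin.succ)
  by_contra h
  have hsub : Incl κ (succ α) := hαo.succ.incl_of_not_mem hκ.isOrd h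
  have hω : Incl (omega M) α := hαo.incl_of_not_mem isOrd_omega fun h => hfin (mem_omega.1 h)
  refine hκ.1.not_cardLE hα ((CardLE.of_incl hsub).trans ?_)
  -- shift the natural numbers by one and send `α` to `0`
  classical
  refine .of_map (fun x => if x = α then emp M else if IsNat x then succ x else x)
    (fun x hx => ?_) fun x y hx hy => ?_
  · by_cases h1 : x = α
    · simpa [h1] using hω _ (mem_omega.2 isNat_emp)
    · by_cases h2 : IsNat x
      · simpa [h1, h2] using hω _ (mem_omega.2 h2.succ)
      · simpa [h1, h2] using hx
  · have hsucc : ∀ x : M, succ x ≠ emp M := fun x e => not_mem_emp (e ▸ mem_succ.2 (.inr rfl))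
    have hinj : ∀ x y : M, succ x = succ y → x = y := fun x y e => by
      have h1 : x ∈ₘ y ∨ x = y := mem_succ.1 (e ▸ mem_succ.2 (.inr rfl))
      have h2 : y ∈ₘ x ∨ y = x := mem_succ.1 (e ▸ mem_succ.2 (.inr rfl))
      rcases h1 with h1 | h1
      · rcases h2 with h2 | h2
        · exact absurd h1 (not_mem_cycle h2)
        · exact h2.symm
      · exact h1
    have hns : ∀ x : M, ¬ IsNat x → x ≠ emp M := fun x h e => h (e ▸ isNat_emp)
    have hns' : ∀ x y : M, ¬ IsNat x → IsNat y → x ≠ succ y := fun x y h hy e => h (e ▸ hy.succ)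
    by_cases h1 : x = α <;> by_cases h2 : y = α <;> by_cases h3 : IsNat x <;>
      by_cases h4 : IsNat y <;> simp only [h1, h2, h3, h4, if_true, if_false] <;> grind

end IsInfCard

/-- Every ordinal `γ` has a cardinality. -/
theorem IsOrd.exists_isCard {γ : M} (hγ : IsOrd γ) :
    ∃ α, α ∈ₘ InZF.succ γ ∧ IsCard α ∧ CardEq γ α := by
  obtain ⟨α, hα, h, hmin⟩ := hγ.exists_least (fun α => CardEq γ α) (.refl γ)
  refine ⟨α, ?_, ⟨hα, fun β hβ e => hmin β hβ (h.trans e.symm)⟩, h⟩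
  rw [mem_succ]
  rcases hα.trichotomy hγ with h1 | h1 | h1
  · exact .inl h1
  · exact .inr h1
  · exact absurd (.refl γ) (hmin γ h1)

theorem CardLE.prod {A B : M} (h : CardLE A B) : CardLE (prod A A) (prod B B) := by
  obtain ⟨F, _, hF, hi⟩ := h.exists_map
  refine .of_map (fun p => opair (F (fst p)) (F (snd p))) (fun p hp => ?_) fun p q hp hq => ?_
  · obtain ⟨a, b, ha, hb, rfl⟩ := mem_prod.1 hp
    simpa using ⟨hF a ha, hF b hb⟩
  · obtain ⟨a, b, ha, hb, rfl⟩ := mem_prod.1 hp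
    obtain ⟨c, d, hc, hd, rfl⟩ := mem_prod.1 hq
    simp only [fst_opair, snd_opair, opair_inj]
    exact fun e => ⟨hi _ _ ha hc e.1, hi _ _ hb hd e.2⟩

/-! ### The canonical well-ordering of pairs of ordinals -/

open Classical in
/-- The maximum of two ordinals. -/
noncomputable def omax (a b : M) : M := if a ∈ₘ b then b else a

instance DefMap.omax (s t : (Fin n → M) → M) [DefMap s] [DefMap t] :
    DefMap fun v => omax (s v) (t v) := by
  unfold InZF.omax; infer_instance

omit hZF in
theorem omax_mem {κ a b : M} (ha : a ∈ₘ κ) (hb : b ∈ₘ κ) : omax a b ∈ₘ κ := by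
  unfold omax; split_ifs <;> assumption

theorem left_mem_succ_omax (a b : M) : a ∈ₘ succ (omax a b) := by
  unfold omax; split_ifs with h <;> simp [h]

theorem right_mem_succ_omax {a b : M} (ha : IsOrd a) (hb : IsOrd b) : b ∈ₘ succ (omax a b) := by
  unfold omax; split_ifs with h
  · simp
  · rcases ha.trichotomy hb with h1 | rfl | h1
    · exact absurd h1 h
    · simp
    · simp [h1]

/-- Pairs are compared by their maxima, then by their first and their second components. -/
def PairLT (q p : M) : Prop :=
  omax (fst q) (snd q) ∈ₘ omax (fst p) (snd p) ∨ (omax (fst q) (snd q) = omax (fst p) (snd p) ∧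
    (fst q ∈ₘ fst p ∨ (fst q = fst p ∧ snd q ∈ₘ snd p)))

instance DefPred.pairLT (s t : (Fin n → M) → M) [DefMap s] [DefMap t] :
    DefPred fun v => PairLT (s v) (t v) := by
  unfold PairLT; infer_instance

theorem exists_min (F : M → M) [DefMap₁ F] {a : M}
    (hne : ∃ x, x ∈ₘ a) : ∃ x, x ∈ₘ a ∧ ∀ y, y ∈ₘ a → ¬ F y ∈ₘ F x := by
  obtain ⟨x, hx⟩ := hne
  obtain ⟨z, hz, hz'⟩ := hZF.out.foundation (image F a) ⟨F x, mem_image.2 ⟨x, hx, rfl⟩⟩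
  obtain ⟨w, hw, rfl⟩ := mem_image.1 hz
  exact ⟨w, hw, fun y hy h => hz' _ h (mem_image.2 ⟨y, hy, rfl⟩)⟩

theorem wfOn_pairLT {κ : M} (hκ : IsOrd κ) :
    WFOn (prod κ κ) fun p => sep (prod κ κ) fun q => PairLT q p := by
  refine ⟨fun x _ y hy => (mem_sep.1 hy).1, fun x hx y hy z hz => ?_, fun a ha hne => ?_⟩
  · simp only [mem_sep] at hy hz ⊢
    refine ⟨hz.1, ?_⟩
    have hyx := hy.2
    have hzy := hz.2
    obtain ⟨a, b, ha, hb, rfl⟩ := mem_prod.1 hx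
    unfold PairLT at hyx hzy ⊢
    simp only [fst_opair, snd_opair] at hyx hzy ⊢
    have h1 := (hκ.mem (omax_mem ha hb)).1
    have h2 := (hκ.mem ha).1
    have h3 := (hκ.mem hb).1
    unfold Incl at h1 h2 h3
    grind
  · obtain ⟨x₁, hx₁, h₁⟩ := exists_min (fun p : M => omax (fst p) (snd p)) hne
    obtain ⟨x₂, hx₂, h₂⟩ := exists_min
      (a := sep a fun p => omax (fst p) (snd p) = omax (fst x₁) (snd x₁)) fst ⟨x₁, by simp [hx₁]⟩
    obtain ⟨x₃, hx₃, h₃⟩ := exists_min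
      (a := sep (sep a fun p => omax (fst p) (snd p) = omax (fst x₁) (snd x₁))
        fun p => fst p = fst x₂) snd ⟨x₂, by simpa using hx₂⟩
    simp only [mem_sep] at hx₂ hx₃ h₂ h₃
    refine ⟨x₃, hx₃.1.1, fun y hy hyx => ?_⟩
    rcases (mem_sep.1 hyx).2 with h | ⟨e, h | ⟨e', h⟩⟩
    · exact h₁ y hy (hx₃.1.2 ▸ h)
    · exact h₂ y ⟨hy, e.trans hx₃.1.2⟩ (hx₃.2 ▸ h)
    · exact h₃ y ⟨⟨hy, e.trans hx₃.1.2⟩, e'.trans hx₃.2⟩ h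

theorem pairLT_total {κ : M} (hκ : IsOrd κ) (x y : M) (hx : x ∈ₘ prod κ κ) (hy : y ∈ₘ prod κ κ) :
    x ∈ₘ (sep (prod κ κ) fun q => PairLT q y) ∨ x = y ∨
      y ∈ₘ (sep (prod κ κ) fun q => PairLT q x) := by
  rw [mem_sep, mem_sep, and_iff_right hx, and_iff_right hy]
  obtain ⟨a, b, ha, hb, rfl⟩ := mem_prod.1 hx
  obtain ⟨c, d, hc, hd, rfl⟩ := mem_prod.1 hy
  unfold PairLT
  simp only [fst_opair, snd_opair, opair_inj]
  have h1 := hκ.2 _ _ (omax_mem ha hb) (omax_mem hc hd)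
  have h2 := hκ.2 _ _ ha hc
  have h3 := hκ.2 _ _ hb hd
  grind

/-- Hessenberg's theorem. No initial segment of the canonical well-ordering of `κ × κ` can have
size `κ`: it lies in some `γ × γ` with `γ < κ`, and induction applies to the cardinality of `γ`. -/
theorem IsInfCard.prod_cardLE {κ : M} (hκ : IsInfCard κ) : CardLE (prod κ κ) κ := by
  refine IsOrd.induction (fun κ => IsInfCard κ → CardLE (prod κ κ) κ) (fun κ hκo ih hκ => ?_)
    hκ.isOrd hκ
  have hwf := wfOn_pairLT hκo
  have htot := pairLT_total hκo
  refine .of_map (fun p => collapse (fun p => sep (prod κ κ) fun q => PairLT q p) p)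
    (fun p hp => ?_) fun p q hp hq e => hwf.collapse_inj htot hp hq e
  by_contra hno
  have hle := hwf.cardLE_pred htot hp hκo hno
  obtain ⟨a, b, ha, hb, rfl⟩ := mem_prod.1 hp
  set γ := succ (omax a b) with hγ
  have hγκ : γ ∈ₘ κ := hκ.succ_mem (omax_mem ha hb)
  have hγo := hκo.mem hγκ
  have hle' : CardLE κ (prod γ γ) := hle.trans (.of_incl fun q hq => by
    obtain ⟨hq, hlt⟩ := mem_sep.1 hq
    obtain ⟨c, d, hc, hd, rfl⟩ := mem_prod.1 hq
    unfold PairLT at hlt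
    simp only [fst_opair, snd_opair] at hlt
    have hm : Incl (succ (omax c d)) γ := fun z hz => by
      have : omax c d ∈ₘ γ := by
        rw [hγ, mem_succ]
        rcases hlt with h | h
        exacts [.inl h, .inr h.1]
      rcases mem_succ.1 hz with h | rfl
      exacts [hγo.trans this h, this]
    exact mem_prod.2 ⟨c, d, hm _ (left_mem_succ_omax c d),
      hm _ (right_mem_succ_omax (hκo.mem hc) (hκo.mem hd)), rfl⟩)
  obtain ⟨α, hα, hαc, e⟩ := hγo.exists_isCard
  have hακ : α ∈ₘ κ := by
    rcases mem_succ.1 hα with h | rfl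
    exacts [hκo.trans hγκ h, hγκ]
  by_cases hfin : IsFin α
  · have : IsFin γ := hfin.of_cardLE e.cardLE
    exact hκ.not_isFin hle' (this.prod this)
  · exact hκ.1.not_cardLE hακ ((hle'.trans e.cardLE.prod).trans (ih α hακ ⟨hαc, hfin⟩))

/-- A definable injective pairing function on an infinite cardinal. -/
theorem IsInfCard.exists_pairing {κ : M} (hκ : IsInfCard κ) : ∃ π : M → M → M, DefMap₂ π ∧
    (∀ a b, a ∈ₘ κ → b ∈ₘ κ → π a b ∈ₘ κ) ∧ ∀ a b c d, a ∈ₘ κ → b ∈ₘ κ → c ∈ₘ κ → d ∈ₘ κ →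
      π a b = π c d → a = c ∧ b = d := by
  obtain ⟨F, _, hF, hi⟩ := hκ.prod_cardLE.exists_map
  refine ⟨fun a b => F (opair a b), inferInstance, fun a b ha hb => hF _ (by simp [ha, hb]),
    fun a b c d ha hb hc hd e => ?_⟩
  exact opair_inj.1 (hi _ _ (by simp [ha, hb]) (by simp [hc, hd]) e)

/-! ### Successor cardinals -/

/-- The ordinals embeddable in `κ` form a set: such an ordinal is recovered by collapsing the
relation that it induces on the range of an embedding, and that relation is a subset of `κ × κ`. -/
theorem exists_bound_cardLE (κ : M) : ∃ Y, ∀ α, IsOrd α → CardLE α κ → Incl α Y := by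
  refine ⟨sUnion (image (fun R => image
    (fun x => collapse (fun y => sep κ fun z => opair z y ∈ₘ R) x) κ) (pow (prod κ κ))),
    fun α hα hle b hb => ?_⟩
  obtain ⟨F, _, hF, hi⟩ := hle.exists_map
  set R := sep (prod κ κ) fun p => ∃ a b, a ∈ₘ b ∧ b ∈ₘ α ∧ p = opair (F a) (F b) with hR
  have hpred : ∀ b z, b ∈ₘ α → (z ∈ₘ (sep κ fun z => opair z (F b) ∈ₘ R) ↔
      ∃ a, a ∈ₘ b ∧ z = F a) := fun b z hb => by
    simp only [mem_sep, hR, opair_inj, mem_prod]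
    constructor
    · rintro ⟨-, -, a, c, hac, hc, rfl, e⟩
      exact ⟨a, hi _ _ hb hc e ▸ hac, rfl⟩
    · rintro ⟨a, ha, rfl⟩
      have := hF a (hα.trans hb ha)
      exact ⟨this, ⟨_, _, this, hF b hb, rfl, rfl⟩, a, b, ha, hb, rfl, rfl⟩
  have hwf : WFOn (image F α) fun y => sep κ fun z => opair z y ∈ₘ R := by
    refine ⟨fun x hx y hy => ?_, fun x hx y hy z hz => ?_, fun s hs hne => ?_⟩
    · obtain ⟨b, hb, rfl⟩ := mem_image.1 hx
      obtain ⟨a, ha, rfl⟩ := (hpred b y hb).1 hy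
      exact mem_image.2 ⟨a, hα.trans hb ha, rfl⟩
    · obtain ⟨b, hb, rfl⟩ := mem_image.1 hx
      obtain ⟨a, ha, rfl⟩ := (hpred b y hb).1 hy
      obtain ⟨c, hc, rfl⟩ := (hpred a z (hα.trans hb ha)).1 hz
      exact (hpred b _ hb).2 ⟨c, (hα.mem hb).trans ha hc, rfl⟩
    · obtain ⟨x, hx⟩ := hne
      obtain ⟨a, ha, rfl⟩ := mem_image.1 (hs x hx)
      obtain ⟨b, hb, hmin⟩ := hZF.out.foundation (sep α fun a => F a ∈ₘ s) ⟨a, by simp [ha, hx]⟩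
      rw [mem_sep] at hb
      refine ⟨F b, hb.2, fun y hy hyb => ?_⟩
      obtain ⟨c, hc, rfl⟩ := (hpred b y hb.1).1 hyb
      exact hmin c hc (mem_sep.2 ⟨hα.trans hb.1 hc, hy⟩)
  have hcol : ∀ b, b ∈ₘ α → collapse (fun y => sep κ fun z => opair z y ∈ₘ R) (F b) = b := by
    intro b hb
    refine IsOrd.induction (fun b => b ∈ₘ α →
      collapse (fun y => sep κ fun z => opair z y ∈ₘ R) (F b) = b) (fun b _ ih hb => ?_)
      (hα.mem hb) hb
    refine ext fun z => ?_
    rw [hwf.mem_collapse (mem_image.2 ⟨b, hb, rfl⟩)]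
    constructor
    · rintro ⟨y, hy, rfl⟩
      obtain ⟨a, ha, rfl⟩ := (hpred b y hb).1 hy
      rwa [ih a ha (hα.trans hb ha)]
    · exact fun hz => ⟨F z, (hpred b _ hb).2 ⟨z, hz, rfl⟩, (ih z hz (hα.trans hb hz)).symm⟩
  refine mem_sUnion.2 ⟨_, mem_image.2 ⟨R, mem_pow.2 fun p hp => (mem_sep.1 hp).1, rfl⟩,
    mem_image.2 ⟨F b, hF b hb, (hcol b hb).symm⟩⟩

theorem exists_isSuccCard {κ : M} (hκ : IsCard κ) : ∃ μ, IsSuccCard μ κ := by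
  obtain ⟨Y, hY⟩ := exists_bound_cardLE κ
  set μ := sep (pow Y) fun α => IsOrd α ∧ CardLE α κ with hμ
  have hmem : ∀ α, α ∈ₘ μ ↔ IsOrd α ∧ CardLE α κ := fun α => by
    rw [hμ, mem_sep, mem_pow, and_iff_right_iff_imp]
    exact fun h => hY α h.1 h.2
  have hord : IsOrd μ := isOrd_of_forall (fun x hx y hy => by
    rw [hmem] at hx ⊢
    exact ⟨hx.1.mem hy, (CardLE.of_incl (hx.1.incl hy)).trans hx.2⟩) fun x hx => ((hmem x).1 hx).1
  have hno : ¬ CardLE μ κ := fun h => not_mem_self μ ((hmem μ).2 ⟨hord, h⟩)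
  refine ⟨μ, ⟨hord, fun β hβ e => hno (e.symm.cardLE.trans ((hmem β).1 hβ).2)⟩,
    (hmem κ).2 ⟨hκ.1, .of_incl (.refl κ)⟩, fun ν hν hκν => ?_⟩
  rcases hord.trichotomy hν.1 with h | h | h
  · exact .inr h
  · exact .inl h
  · exact absurd ((hmem ν).1 h).2 (hν.not_cardLE hκν)

/-! ### Trees coded by an infinite cardinal -/

/-- A set each of whose elements is determined by some element of a set of size at most `κ` has
size at most `κ`: the least code is chosen. -/
theorem CardLE.of_cover {R A κ : M} (hR : CardLE R κ) (hκ : IsOrd κ) (Q : M → M → Prop)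
    [DefPred₂ Q] (hcov : ∀ a, a ∈ₘ A → ∃ r, r ∈ₘ R ∧ Q r a)
    (hQ : ∀ r a b, r ∈ₘ R → a ∈ₘ A → b ∈ₘ A → Q r a → Q r b → a = b) : CardLE A κ := by
  obtain ⟨F, _, hF, hi⟩ := hR.exists_map
  have key : ∀ a, a ∈ₘ A → least (sep κ fun c => ∃ r, r ∈ₘ R ∧ Q r a ∧ F r = c) ∈ₘ
      sep κ fun c => ∃ r, r ∈ₘ R ∧ Q r a ∧ F r = c := fun a ha => by
    obtain ⟨r, hr, hra⟩ := hcov a ha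
    exact (least_spec (fun x hx => hκ.mem (mem_sep.1 hx).1)
      ⟨F r, mem_sep.2 ⟨hF r hr, r, hr, hra, rfl⟩⟩).1
  refine .of_map (fun a => least (sep κ fun c => ∃ r, r ∈ₘ R ∧ Q r a ∧ F r = c))
    (fun a ha => (mem_sep.1 (key a ha)).1) fun a b ha hb e => ?_
  obtain ⟨-, r, hr, hra, h1⟩ := mem_sep.1 (key a ha)
  obtain ⟨-, s, hs, hsb, h2⟩ := mem_sep.1 (key b hb)
  obtain rfl := hi r s hr hs (h1.trans (e.trans h2.symm))
  exact hQ r a b hr ha hb hra hsb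

/-- Suppose that each set `r` has a set `S r` of possible new elements, which `J r` injects into
the infinite cardinal `κ`. Then the sets obtained from `r₀` by successively adding possible new
elements form a family of size at most `κ`. Such a set is coded by an element of `κ`, built with
a pairing function from the code of its parent and the value of `J` at the last element added; the
relation between sets and codes is the least one closed under this operation. -/
theorem exists_tree {κ : M} (hκ : IsInfCard κ) (U r₀ : M) (S : M → M) (J : M → M → M)
    [DefMap₁ S] [DefMap₂ J] (hr₀ : Incl r₀ U) (hS : ∀ r, Incl (S r) U)
    (hJ : ∀ r x, x ∈ₘ S r → J r x ∈ₘ κ)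
    (hi : ∀ r x y, x ∈ₘ S r → y ∈ₘ S r → J r x = J r y → x = y) :
    ∃ R, CardLE R κ ∧ r₀ ∈ₘ R ∧ ∀ r x, r ∈ₘ R → x ∈ₘ S r → adj r x ∈ₘ R := by
  obtain ⟨π, _, hπ, hπi⟩ := hκ.exists_pairing
  have h0 : emp M ∈ₘ κ := hκ.emp_mem
  have h1 : succ (emp M) ∈ₘ κ := hκ.succ_mem h0
  have h01 : emp M ≠ succ (emp M) := fun e => not_mem_emp (e ▸ mem_succ.2 (.inr rfl))
  -- the first component of a code tells the root from the other nodes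
  set c₀ := π (emp M) (emp M) with hc₀
  have hc₀κ : c₀ ∈ₘ κ := hπ _ _ h0 h0
  let node : M → M → M := fun c j => π (succ (emp M)) (π c j)
  have hnode : ∀ c j, c ∈ₘ κ → j ∈ₘ κ → node c j ∈ₘ κ := fun c j hc hj => hπ _ _ h1 (hπ _ _ hc hj)
  have hnode0 : ∀ c j, c ∈ₘ κ → j ∈ₘ κ → node c j ≠ c₀ := fun c j hc hj e =>
    h01 (hπi _ _ _ _ h1 (hπ _ _ hc hj) h0 h0 e).1.symm
  have hnodei : ∀ c j c' j', c ∈ₘ κ → j ∈ₘ κ → c' ∈ₘ κ → j' ∈ₘ κ → node c j = node c' j' →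
      c = c' ∧ j = j' := fun c j c' j' hc hj hc' hj' e =>
    hπi _ _ _ _ hc hj hc' hj' (hπi _ _ _ _ h1 (hπ _ _ hc hj) h1 (hπ _ _ hc' hj') e).2
  have : DefMap₂ node := inferInstanceAs <| DefMap₂ fun c j => π (succ (emp M)) (π c j)
  let Closed : M → Prop := fun Z => opair r₀ c₀ ∈ₘ Z ∧
    ∀ r c x, opair r c ∈ₘ Z → x ∈ₘ S r → opair (adj r x) (node c (J r x)) ∈ₘ Z
  have : DefPred₁ Closed := inferInstanceAs <| DefPred₁ fun Z => opair r₀ c₀ ∈ₘ Z ∧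
    ∀ r c x, opair r c ∈ₘ Z → x ∈ₘ S r → opair (adj r x) (node c (J r x)) ∈ₘ Z
  set E := sep (prod (pow U) κ) fun p => ∀ Z, Closed Z → p ∈ₘ Z with hE
  have hEmem : ∀ r c, opair r c ∈ₘ E → Incl r U ∧ c ∈ₘ κ := fun r c h => by
    obtain ⟨a, b, ha, hb, e⟩ := mem_prod.1 (mem_sep.1 h).1
    obtain ⟨rfl, rfl⟩ := opair_inj.1 e
    exact ⟨mem_pow.1 ha, hb⟩
  have hEroot : opair r₀ c₀ ∈ₘ E :=
    mem_sep.2 ⟨mem_prod.2 ⟨_, _, mem_pow.2 hr₀, hc₀κ, rfl⟩, fun Z hZ => hZ.1⟩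
  have hEstep : ∀ r c x, opair r c ∈ₘ E → x ∈ₘ S r →
      opair (adj r x) (node c (J r x)) ∈ₘ E := fun r c x h hx => by
    refine mem_sep.2 ⟨mem_prod.2 ⟨_, _, mem_pow.2 fun y hy => ?_,
      hnode _ _ (hEmem r c h).2 (hJ r x hx), rfl⟩, fun Z hZ => hZ.2 r c x ((mem_sep.1 h).2 Z hZ) hx⟩
    rcases mem_adj.1 hy with hy | rfl
    exacts [(hEmem r c h).1 y hy, hS r y hx]
  have hinv : ∀ s d, opair s d ∈ₘ E → (s = r₀ ∧ d = c₀) ∨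
      ∃ r c x, opair r c ∈ₘ E ∧ x ∈ₘ S r ∧ s = adj r x ∧ d = node c (J r x) := fun s d h => by
    have hcl : Closed (sep E fun p => p = opair r₀ c₀ ∨
        ∃ r c x, opair r c ∈ₘ E ∧ x ∈ₘ S r ∧ p = opair (adj r x) (node c (J r x))) :=
      ⟨mem_sep.2 ⟨hEroot, .inl rfl⟩, fun r c x hrc hx =>
        have hrc := (mem_sep.1 hrc).1
        mem_sep.2 ⟨hEstep r c x hrc hx, .inr ⟨r, c, x, hrc, hx, rfl⟩⟩⟩
    have := (mem_sep.1 ((mem_sep.1 h).2 _ hcl)).2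
    simpa only [opair_inj] using this
  -- a code determines the set that it codes
  have hfun : ∀ s d s', opair s d ∈ₘ E → opair s' d ∈ₘ E → s' = s := fun s d s' h h' => by
    have hcl : Closed (sep E fun p => ∀ s', opair s' (snd p) ∈ₘ E → s' = fst p) := by
      refine ⟨mem_sep.2 ⟨hEroot, fun s' hs' => ?_⟩, fun r c x hrc hx => ?_⟩
      · rw [snd_opair] at hs'
        rw [fst_opair]
        rcases hinv _ _ hs' with h | ⟨r, c, x, hrc, hx, rfl, e⟩
        · exact h.1
        · exact absurd e.symm (hnode0 _ _ (hEmem r c hrc).2 (hJ r x hx))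
      · obtain ⟨hrc, ih⟩ := mem_sep.1 hrc
        refine mem_sep.2 ⟨hEstep r c x hrc hx, fun s' hs' => ?_⟩
        rw [snd_opair] at hs' ih
        rw [fst_opair] at ih ⊢
        rcases hinv _ _ hs' with h | ⟨r', c', x', hrc', hx', rfl, e⟩
        · exact absurd h.2 (hnode0 _ _ (hEmem r c hrc).2 (hJ r x hx))
        · obtain ⟨rfl, e'⟩ := hnodei _ _ _ _ (hEmem r c hrc).2 (hJ r x hx) (hEmem r' c' hrc').2
            (hJ r' x' hx') e
          obtain rfl := ih r' hrc'
          rw [hi _ _ _ hx hx' e']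
    have := (mem_sep.1 ((mem_sep.1 h).2 _ hcl)).2 s' (by rwa [snd_opair])
    rwa [fst_opair] at this
  refine ⟨image fst E, ?_, mem_image.2 ⟨_, hEroot, by simp⟩, fun r x hr hx => ?_⟩
  · refine CardLE.of_cover (R := κ) (.of_incl (.refl κ)) hκ.isOrd (fun c r => opair r c ∈ₘ E)
      (fun r hr => ?_) fun c r s _ _ _ h h' => hfun _ _ _ h' h
    obtain ⟨p, hp, rfl⟩ := mem_image.1 hr
    obtain ⟨a, c, -, hc, rfl⟩ := mem_prod.1 (mem_sep.1 hp).1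
    exact ⟨c, hc, by simpa using hp⟩
  · obtain ⟨p, hp, rfl⟩ := mem_image.1 hr
    obtain ⟨a, c, -, hc, rfl⟩ := mem_prod.1 (mem_sep.1 hp).1
    rw [fst_opair] at hx ⊢
    exact mem_image.2 ⟨_, hEstep a c x hp hx, by simp⟩

/-! ### Greedy subsets -/

open Classical in
/-- The greedy subset `B` of a set `X` of ordinals for the relation `Q`: going through `X` in
increasing order, `ξ` is put into `B` when `Q η ξ` holds for all `η` put into `B` before. The
recursion has the value `{ξ}` at `ξ` if `ξ` is put into `B`, and `∅` otherwise. -/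
noncomputable def greedy (X : M) (Q : M → M → Prop) : M :=
  sep X fun ξ => ξ ∈ₘ wfRec (fun x => x)
    (fun x s => if x ∈ₘ X ∧ ∀ η, η ∈ₘ sUnion s → Q η x then upair x x else emp M) ξ

instance DefMap.greedy (t : (Fin n → M) → M) (Q : (Fin n → M) → M → M → Prop) [DefMap t]
    [DefPred fun w : Fin (n + 1 + 1) → M => Q (init (init w)) (last (init w)) (last w)] :
    DefMap fun v => greedy (t v) (Q v) := by
  unfold InZF.greedy; infer_instance

theorem mem_greedy {α X : M} (hα : IsOrd α) (hX : Incl X α) {Q : M → M → Prop} [DefPred₂ Q]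
    {ξ : M} : ξ ∈ₘ greedy X Q ↔ ξ ∈ₘ X ∧ ∀ η, η ∈ₘ greedy X Q → η ∈ₘ ξ → Q η ξ := by
  classical
  set F := wfRec (fun x => x)
    (fun x s => if x ∈ₘ X ∧ ∀ η, η ∈ₘ sUnion s → Q η x then upair x x else emp M) with hF
  have hFd : DefMap₁ F := hF ▸ inferInstance
  have hg : ∀ ξ, ξ ∈ₘ greedy X Q ↔ ξ ∈ₘ X ∧ ξ ∈ₘ F ξ := fun ξ => mem_sep
  have hFeq : ∀ x, x ∈ₘ α → F x =
      if x ∈ₘ X ∧ ∀ η, η ∈ₘ sUnion (image F x) → Q η x then upair x x else emp M :=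
    fun x hx => hα.wfOn.wfRec_eq _ hx
  have hFmem : ∀ x y, x ∈ₘ α → y ∈ₘ F x → y = x ∧ x ∈ₘ X := fun x y hx hy => by
    rw [hFeq x hx] at hy
    split_ifs at hy with h
    · exact ⟨by simpa using hy, h.1⟩
    · exact absurd hy not_mem_emp
  have hun : ∀ x η, x ∈ₘ α → (η ∈ₘ sUnion (image F x) ↔ η ∈ₘ greedy X Q ∧ η ∈ₘ x) :=
    fun x η hx => by
      rw [mem_sUnion, hg]
      constructor
      · rintro ⟨y, hy, hηy⟩
        obtain ⟨z, hz, rfl⟩ := mem_image.1 hy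
        obtain ⟨rfl, h⟩ := hFmem z η (hα.trans hx hz) hηy
        exact ⟨⟨h, hηy⟩, hz⟩
      · rintro ⟨⟨-, h⟩, hηx⟩
        exact ⟨F η, mem_image.2 ⟨η, hηx, rfl⟩, h⟩
  rw [hg, and_congr_right_iff]
  intro hξ
  have hξα := hX ξ hξ
  rw [hFeq ξ hξα]
  simp only [hξ, true_and, hun ξ _ hξα, and_imp]
  split_ifs with h
  · simpa using h
  · simpa using h

/-! ### The partition relation for points and small trees -/

section Combinatorics

variable {κ μ : M} (hκ : IsInfCard κ) (hμ : IsCard μ) (hκμ : κ ∈ₘ μ)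
include hκ hμ hκμ

/-- Without a monochromatic set of order type `κ`, a point would be determined by its colour and its
rank in its colour class, hence by an element of `κ × κ`. -/
theorem arrowOne : ArrowOne μ κ κ := by
  intro f hf
  by_contra hcon
  obtain ⟨π, _, hπ, hπi⟩ := hκ.exists_pairing
  set fib : M → M := fun i => sep μ fun x => app f x = i with hfib
  have : DefMap₁ fib := inferInstanceAs <| DefMap₁ fun i => sep μ fun x => app f x = i
  have hfo : ∀ i x, x ∈ₘ fib i → IsOrd x := fun i x hx => hμ.1.mem (mem_sep.1 hx).1
  have hmem : ∀ x, x ∈ₘ μ → x ∈ₘ fib (app f x) := fun x hx => mem_sep.2 ⟨hx, rfl⟩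
  have hrk : ∀ x, x ∈ₘ μ → rk (fib (app f x)) x ∈ₘ κ := fun x hx => by
    by_contra h
    obtain ⟨H, hH, hot, -⟩ := exists_hasOrderType (hfo _) hκ.isOrd (hmem x hx) h
    refine hcon ⟨H, app f x, fun y hy => (mem_sep.1 (hH y hy)).1, hot, fun y hy => ?_⟩
    obtain ⟨hyμ, e⟩ := mem_sep.1 (hH y hy)
    rw [pairMem_iff, hf.mem_iff]
    exact ⟨hyμ, e.symm⟩
  refine hμ.not_cardLE hκμ (.of_map (fun x => π (app f x) (rk (fib (app f x)) x))
    (fun x hx => hπ _ _ (hf.app_mem hx) (hrk x hx)) fun x y hx hy e => ?_)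
  obtain ⟨e1, e2⟩ := hπi _ _ _ _ (hf.app_mem hx) (hrk x hx) (hf.app_mem hy) (hrk y hy) e
  rw [← e1] at e2
  exact rk_inj (hfo _) (hmem x hx) (e1 ▸ hmem y hy) e2

omit hκ hμ hκμ in
/-- A finite sequence has only one length. -/
theorem IsOrdSeq.length_unique {s n m : M} (hn : IsOrdSeq s n) (hm : IsOrdSeq s m) : n = m := by
  have key : ∀ n m : M, IsOrdSeq s n → IsOrdSeq s m → Incl n m := fun n m hn hm i hi => by
    obtain ⟨a, ha, -⟩ := hn.2.2 i hi
    obtain ⟨j, b, hj, -, e⟩ := hm.2.1 _ (pairMem_iff.1 ha)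
    rwa [(opair_inj.1 (isOPair_iff.1 e)).1]
  exact (key n m hn hm).antisymm (key m n hm hn)

omit hκ hμ hκμ in
theorem isSnoc_iff {t s a : M} : IsSnoc t s a ↔ ∃ n, IsOrdSeq s n ∧ t = adj s (opair n a) :=
  exists_congr fun n => and_congr_right fun _ =>
    ⟨fun h => ext fun p => by simp [h p], by rintro rfl p; simp⟩

omit hμ hκμ in
/-- `exists_tree` applies with sequences regarded as sets of pairs: the elements that may be added
to a sequence of length `n` are the pairs `(n, a)`. -/
theorem treeBound : TreeBound κ κ := by
  intro T hT hB
  set B : M → M := fun s =>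
    the fun B => ∀ a, a ∈ₘ B ↔ IsOrd a ∧ ∃ t, t ∈ₘ T ∧ ∃ n, IsOrdSeq s n ∧ t = adj s (opair n a)
    with hBdef
  have : DefMap₁ B := inferInstanceAs <| DefMap₁ fun s => the fun B => ∀ a, a ∈ₘ B ↔
    IsOrd a ∧ ∃ t, t ∈ₘ T ∧ ∃ n, IsOrdSeq s n ∧ t = adj s (opair n a)
  have hBmem : ∀ s, s ∈ₘ T → ∀ a, a ∈ₘ B s ↔
      IsOrd a ∧ ∃ t, t ∈ₘ T ∧ ∃ n, IsOrdSeq s n ∧ t = adj s (opair n a) := fun s hs a => by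
    obtain ⟨b, hb, -⟩ := hB s hs
    exact the_set_spec ⟨b, fun a => by simpa only [isSnoc_iff] using hb a⟩ a
  have hBrk : ∀ s a, s ∈ₘ T → a ∈ₘ B s → rk (B s) a ∈ₘ κ := fun s a hs ha => by
    by_contra h
    obtain ⟨H, hH, -, e⟩ :=
      exists_hasOrderType (fun x hx => ((hBmem s hs x).1 hx).1) hκ.isOrd ha h
    have hle : CardLE κ (B s) := e.symm.cardLE.trans (.of_incl hH)
    obtain ⟨b, hb, hlt, hne⟩ := hB s hs
    have hbB : b = B s := ext fun a => by simp only [hb a, isSnoc_iff, hBmem s hs a]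
    rw [hbB] at hlt hne
    obtain ⟨β, hβ, e'⟩ := hlt.exists_cardEq hκ.isOrd
    rcases mem_succ.1 hβ with hβ | hβ
    · exact hκ.1.not_cardLE hβ (hle.trans e'.cardLE)
    · exact hne (hβ ▸ e')
  set S : M → M := fun s => sep (sUnion T) fun p =>
    s ∈ₘ T ∧ ∃ n a, IsOrdSeq s n ∧ p = opair n a ∧ IsOrd a ∧ adj s p ∈ₘ T with hS
  have : DefMap₁ S := inferInstanceAs <| DefMap₁ fun s => sep (sUnion T) fun p =>
    s ∈ₘ T ∧ ∃ n a, IsOrdSeq s n ∧ p = opair n a ∧ IsOrd a ∧ adj s p ∈ₘ T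
  have hSB : ∀ s p, p ∈ₘ S s → s ∈ₘ T ∧ ∃ n a, IsOrdSeq s n ∧ p = opair n a ∧ a ∈ₘ B s :=
    fun s p hp => by
      obtain ⟨-, hs, n, a, hn, rfl, ha, ht⟩ := mem_sep.1 hp
      exact ⟨hs, n, a, hn, rfl, (hBmem s hs a).2 ⟨ha, _, ht, n, hn, rfl⟩⟩
  obtain ⟨R, hR, hroot, hstep⟩ := exists_tree hκ (sUnion T) (emp M) S
    (fun s p => rk (B s) (snd p)) (fun z hz => absurd hz not_mem_emp)
    (fun s p hp => (mem_sep.1 hp).1)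
    (fun s p hp => by
      obtain ⟨hs, n, a, -, rfl, ha⟩ := hSB s p hp
      simpa using hBrk s a hs ha)
    (fun s p q hp hq e => by
      obtain ⟨hs, n, a, hn, rfl, ha⟩ := hSB s p hp
      obtain ⟨-, m, b, hm, rfl, hb⟩ := hSB s q hq
      rw [snd_opair, snd_opair] at e
      rw [hn.length_unique hm, rk_inj (fun x hx => ((hBmem s hs x).1 hx).1) ha hb e])
  refine (CardLE.of_incl fun s hs => ?_).trans hR
  obtain ⟨n, hn⟩ := hT.1 s hs
  refine IsNat.induction (fun n => ∀ s, s ∈ₘ T → IsOrdSeq s n → s ∈ₘ R) ?_ ?_ hn.1 s hs hn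
  · intro s _ hs0
    have : s = emp M := eq_emp fun p hp => by
      obtain ⟨i, a, hi, -⟩ := hs0.2.1 p hp
      exact not_mem_emp hi
    rwa [this]
  · intro k hk ih s hs hsk
    set s' := sep s fun p => ∃ i a, i ∈ₘ k ∧ p = opair i a with hs'
    have hs'k : IsOrdSeq s' k := by
      refine ⟨hk, fun p hp => ?_, fun i hi => ?_⟩
      · obtain ⟨hp, i, a, hi, rfl⟩ := mem_sep.1 hp
        obtain ⟨j, b, -, hb, e⟩ := hsk.2.1 _ hp
        obtain ⟨rfl, rfl⟩ := opair_inj.1 (isOPair_iff.1 e)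
        exact ⟨i, a, hi, hb, isOPair_iff.2 rfl⟩
      · obtain ⟨a, ha, hu⟩ := hsk.2.2 i (mem_succ.2 (.inl hi))
        refine ⟨a, pairMem_iff.2 (mem_sep.2 ⟨pairMem_iff.1 ha, i, a, hi, rfl⟩), fun b hb => ?_⟩
        exact hu b (pairMem_iff.2 (mem_sep.1 (pairMem_iff.1 hb)).1)
    have hs'T : s' ∈ₘ T := hT.2 s s' k hs hs'k fun p hp => (mem_sep.1 hp).1
    obtain ⟨a, ha, hu⟩ := hsk.2.2 k (mem_succ.2 (.inr rfl))
    rw [pairMem_iff] at ha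
    obtain ⟨j, b, -, hb, e⟩ := hsk.2.1 _ ha
    obtain ⟨rfl, rfl⟩ := opair_inj.1 (isOPair_iff.1 e)
    have hadj : s = adj s' (opair k a) := ext fun p => by
      rw [mem_adj]
      constructor
      · intro hp
        obtain ⟨i, b, hi, -, e⟩ := hsk.2.1 p hp
        obtain rfl := isOPair_iff.1 e
        rcases mem_succ.1 hi with hi | rfl
        · exact .inl (mem_sep.2 ⟨hp, i, b, hi, rfl⟩)
        · rw [hu b (pairMem_iff.2 hp)]; exact .inr rfl
      · rintro (hp | rfl)
        exacts [(mem_sep.1 hp).1, ha]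
    rw [hadj]
    exact hstep _ _ (ih s' hs'T hs'k) (mem_sep.2 ⟨mem_sUnion.2 ⟨s, hs, ha⟩, hs'T, k, a, hs'k, rfl,
      hb, hadj ▸ hs⟩)

/-! ### Regressive functions -/

omit hκ hκμ hμ in
/-- An ordinal `ξ` is determined by any set whose greatest element is `ξ`. -/
theorem eq_of_greatest {r ξ η : M} (h : ξ ∈ₘ r ∧ Incl r (succ ξ)) (h' : η ∈ₘ r ∧ Incl r (succ η)) :
    ξ = η := by
  rcases mem_succ.1 (h'.2 ξ h.1) with h1 | h1
  · rcases mem_succ.1 (h.2 η h'.1) with h2 | h2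
    · exact absurd h1 (not_mem_cycle h2)
    · exact h2.symm
  · exact h1

/-- If all fibres of `f` are small, the sets `{0, …, f (f ξ), f ξ, ξ}` are the nodes of a tree as in
`exists_tree`, in which `r` is extended by the nonzero points of the fibre over its greatest
element. -/
theorem regressive : Regressive μ κ := by
  intro f hf
  by_contra hcon
  set S : M → M := fun r => sep μ fun ξ =>
    ξ ≠ emp M ∧ app f ξ ∈ₘ r ∧ Incl r (succ (app f ξ)) with hS
  have : DefMap₁ S := inferInstanceAs <| DefMap₁ fun r => sep μ fun ξ =>
    ξ ≠ emp M ∧ app f ξ ∈ₘ r ∧ Incl r (succ (app f ξ))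
  have hSo : ∀ r x, x ∈ₘ S r → IsOrd x := fun r x hx => hμ.1.mem (mem_sep.1 hx).1
  have hlt : ∀ ξ, ξ ∈ₘ μ → ξ ≠ emp M → app f ξ ∈ₘ ξ := fun ξ hξ hne =>
    hf.2 ξ _ (pairMem_iff.2 (hf.1.mem_iff.2 ⟨hξ, rfl⟩)) (by simpa using hne)
  have h0 : emp M ∈ₘ μ := hμ.1.trans hκμ hκ.emp_mem
  obtain ⟨R, hR, hroot, hstep⟩ := exists_tree hκ μ (upair (emp M) (emp M)) S
    (fun r ξ => rk (S r) ξ) (fun z hz => by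
      obtain rfl : z = emp M := by simpa using hz
      exact h0)
    (fun r ξ hξ => (mem_sep.1 hξ).1)
    (fun r ξ hξ => by
      by_contra h
      obtain ⟨H, hH, -, e⟩ := exists_hasOrderType (hSo r) hκ.isOrd hξ h
      have hξ' := mem_sep.1 hξ
      refine hcon ⟨app f ξ, sep μ fun x => PairMem f x (app f ξ), hf.1.app_mem hξ'.1,
        fun x => mem_sep, e.symm.cardLE.trans (.of_incl fun x hx => ?_)⟩
      have hx := mem_sep.1 (hH x hx)
      refine mem_sep.2 ⟨hx.1, pairMem_iff.2 (hf.1.mem_iff.2 ⟨hx.1, ?_⟩)⟩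
      exact eq_of_greatest hξ'.2.2 hx.2.2)
    (fun r x y hx hy e => rk_inj (hSo r) hx hy e)
  refine hμ.not_cardLE hκμ (hR.of_cover hκ.isOrd (fun r ξ => ξ ∈ₘ r ∧ Incl r (succ ξ))
    (fun ξ hξ => ?_) fun r ξ η _ _ _ h h' => eq_of_greatest h h')
  refine IsOrd.induction (fun ξ => ξ ∈ₘ μ → ∃ r, r ∈ₘ R ∧ ξ ∈ₘ r ∧ Incl r (succ ξ))
    (fun ξ hξo ih hξ => ?_) (hμ.1.mem hξ) hξ
  by_cases hne : ξ = emp M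
  · exact ⟨_, hroot, by simp [hne], fun z hz => by simpa [hne] using hz⟩
  obtain ⟨r, hr, hmem, hincl⟩ := ih _ (hlt ξ hξ hne) (hf.1.app_mem hξ)
  refine ⟨_, hstep r ξ hr (mem_sep.2 ⟨hξ, hne, hmem, hincl⟩), by simp, fun z hz => ?_⟩
  rcases mem_adj.1 hz with hz | rfl
  · rw [mem_succ]
    rcases mem_succ.1 (hincl z hz) with h | rfl
    exacts [.inl (hξo.trans (hlt ξ hξ hne) h), .inl (hlt ξ hξ hne)]
  · simp

/-! ### Δ-systems -/

-- the definability proof for the coding of the children exceeds the default size of instances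
set_option synthInstance.maxSize 1000 in
/-- If the greedy Δ-subsystems with root `r` all have size less than `κ`, then every member of the
family is reached by successively adding elements that occur in such a subsystem. -/
theorem deltaArrow : DeltaArrow μ κ := by
  intro A hA hAμ
  by_contra hcon
  obtain ⟨π, _, hπ, hπi⟩ := hκ.exists_pairing
  obtain ⟨G, _, hG, hGi, hGs⟩ := hAμ.symm.exists_map
  have hGo : ∀ ξ, ξ ∈ₘ μ → ∀ x, x ∈ₘ G ξ → IsOrd x := fun ξ hξ => (hA _ (hG ξ hξ)).2
  set B : M → M := fun r => greedy (sep μ fun ξ => Incl r (G ξ) ∧ G ξ ≠ r)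
    (fun η ξ => ∀ x, x ∈ₘ G η → x ∈ₘ G ξ → x ∈ₘ r) with hB
  have : DefMap₁ B := inferInstanceAs <| DefMap₁ fun r =>
    greedy (sep μ fun ξ => Incl r (G ξ) ∧ G ξ ≠ r)
      (fun η ξ => ∀ x, x ∈ₘ G η → x ∈ₘ G ξ → x ∈ₘ r)
  have hBmem : ∀ r ξ, ξ ∈ₘ B r ↔ ξ ∈ₘ (sep μ fun ξ => Incl r (G ξ) ∧ G ξ ≠ r) ∧
      ∀ η, η ∈ₘ B r → η ∈ₘ ξ → ∀ x, x ∈ₘ G η → x ∈ₘ G ξ → x ∈ₘ r := fun r ξ =>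
    mem_greedy hμ.1 fun x hx => (mem_sep.1 hx).1
  have hBμ : ∀ r ξ, ξ ∈ₘ B r → ξ ∈ₘ μ ∧ Incl r (G ξ) := fun r ξ hξ =>
    have h := mem_sep.1 ((hBmem r ξ).1 hξ).1
    ⟨h.1, h.2.1⟩
  have hBo : ∀ r ξ, ξ ∈ₘ B r → IsOrd ξ := fun r ξ hξ => hμ.1.mem (hBμ r ξ hξ).1
  have hBrk : ∀ r ξ, ξ ∈ₘ B r → rk (B r) ξ ∈ₘ κ := fun r ξ hξ => by
    by_contra h
    obtain ⟨H, hH, -, e⟩ := exists_hasOrderType (hBo r) hκ.isOrd hξ h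
    have hHμ : ∀ x, x ∈ₘ H → x ∈ₘ μ := fun x hx => (hBμ r x (hH x hx)).1
    refine hcon ⟨image G H, fun a ha => ?_, ?_, r, fun a b ha hb hne x => ?_⟩
    · obtain ⟨η, hη, rfl⟩ := mem_image.1 ha
      exact hG η (hHμ η hη)
    · refine CardEq.trans (.symm (.of_map G (fun x hx => mem_image.2 ⟨x, hx, rfl⟩)
        (fun x y hx hy e => hGi x y (hHμ x hx) (hHμ y hy) e) fun y hy => ?_)) e
      obtain ⟨x, hx, rfl⟩ := mem_image.1 hy
      exact ⟨x, hx, rfl⟩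
    · obtain ⟨η, hη, rfl⟩ := mem_image.1 ha
      obtain ⟨ζ, hζ, rfl⟩ := mem_image.1 hb
      refine ⟨fun hx => ⟨(hBμ r η (hH η hη)).2 x hx, (hBμ r ζ (hH ζ hζ)).2 x hx⟩, fun hx => ?_⟩
      rcases (hBo r η (hH η hη)).trichotomy (hBo r ζ (hH ζ hζ)) with h | rfl | h
      · exact ((hBmem r ζ).1 (hH ζ hζ)).2 η (hH η hη) h x hx.1 hx.2
      · exact absurd rfl hne
      · exact ((hBmem r η).1 (hH η hη)).2 ζ (hH ζ hζ) h x hx.2 hx.1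
  have hGrk : ∀ ξ x, ξ ∈ₘ μ → x ∈ₘ G ξ → rk (G ξ) x ∈ₘ κ := fun ξ x hξ hx => by
    by_contra h
    obtain ⟨H, hH, -, e⟩ := exists_hasOrderType (hGo ξ hξ) hκ.isOrd hx h
    exact hκ.not_isFin (e.symm.cardLE.trans (.of_incl hH)) (hA _ (hG ξ hξ)).1
  set S : M → M := fun r => sep (sUnion A) fun x => ¬ x ∈ₘ r ∧ ∃ ξ, ξ ∈ₘ B r ∧ x ∈ₘ G ξ with hS
  have : DefMap₁ S := inferInstanceAs <| DefMap₁ fun r =>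
    sep (sUnion A) fun x => ¬ x ∈ₘ r ∧ ∃ ξ, ξ ∈ₘ B r ∧ x ∈ₘ G ξ
  -- the first member of the greedy subsystem that contains `x`
  set idx : M → M → M := fun r x => least (sep (B r) fun ξ => x ∈ₘ G ξ) with hidx
  have : DefMap₂ idx := inferInstanceAs <| DefMap₂ fun r x => least (sep (B r) fun ξ => x ∈ₘ G ξ)
  have hidxS : ∀ r x, x ∈ₘ S r → idx r x ∈ₘ B r ∧ x ∈ₘ G (idx r x) := fun r x hx => by
    obtain ⟨-, -, ξ, hξ, hxξ⟩ := mem_sep.1 hx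
    exact mem_sep.1 (least_spec (fun η hη => hBo r η (mem_sep.1 hη).1)
      ⟨ξ, mem_sep.2 ⟨hξ, hxξ⟩⟩).1
  obtain ⟨R, hR, hroot, hstep⟩ := exists_tree hκ (sUnion A) (emp M) S
    (fun r x => π (rk (B r) (idx r x)) (rk (G (idx r x)) x)) (fun z hz => absurd hz not_mem_emp)
    (fun r x hx => (mem_sep.1 hx).1)
    (fun r x hx => by
      obtain ⟨h1, h2⟩ := hidxS r x hx
      exact hπ _ _ (hBrk r _ h1) (hGrk _ x (hBμ r _ h1).1 h2))
    (fun r x y hx hy e => by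
      obtain ⟨h1, h2⟩ := hidxS r x hx
      obtain ⟨h3, h4⟩ := hidxS r y hy
      have hμ1 := (hBμ r _ h1).1
      obtain ⟨e1, e2⟩ := hπi _ _ _ _ (hBrk r _ h1) (hGrk _ x hμ1 h2)
        (hBrk r _ h3) (hGrk _ y (hBμ r _ h3).1 h4) e
      have e3 := rk_inj (hBo r) h1 h3 e1
      rw [← e3] at e2 h4
      exact rk_inj (hGo _ hμ1) h2 h4 e2)
  refine hμ.not_cardLE hκμ ((hAμ.symm.cardLE.trans (.of_incl fun a ha => ?_)).trans hR)
  obtain ⟨z, hz, hmax⟩ := (hA a ha).1.exists_maximal (Z := sep R fun r => Incl r a)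
    (fun z hz => (mem_sep.1 hz).2)
    ⟨emp M, mem_sep.2 ⟨hroot, fun z hz => absurd hz not_mem_emp⟩⟩
  obtain ⟨hzR, hza⟩ := mem_sep.1 hz
  by_cases hne : z = a
  · rwa [← hne]
  exfalso
  obtain ⟨ξ, hξ, rfl⟩ := hGs a ha
  have hξX : ξ ∈ₘ sep μ fun ξ => Incl z (G ξ) ∧ G ξ ≠ z := mem_sep.2 ⟨hξ, hza, Ne.symm hne⟩
  have hx : ∃ x, x ∈ₘ G ξ ∧ ¬ x ∈ₘ z ∧ ∃ η, η ∈ₘ B z ∧ x ∈ₘ G η := by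
    by_cases hξB : ξ ∈ₘ B z
    · by_contra hno
      push Not at hno
      refine hne (hza.antisymm fun x hx => ?_)
      by_contra hxz
      exact hno x hx hxz ξ hξB hx
    · rw [hBmem, and_iff_right hξX] at hξB
      push Not at hξB
      obtain ⟨η, hη, -, x, hxη, hxξ, hxz⟩ := hξB
      exact ⟨x, hxξ, hxz, η, hη, hxη⟩
  obtain ⟨x, hxξ, hxz, hη⟩ := hx
  have h1 := hmax (adj z x) (mem_sep.2 ⟨hstep z x hzR
    (mem_sep.2 ⟨mem_sUnion.2 ⟨_, ha, hxξ⟩, hxz, hη⟩), fun y hy => by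
      rcases mem_adj.1 hy with hy | rfl
      exacts [hza y hy, hxξ]⟩) fun y hy => mem_adj.2 (.inl hy)
  exact hxz (h1 ▸ mem_adj.2 (.inr rfl))

/-! ### The partition relation for pairs -/

/-- If all greedy `0`-homogeneous sets of upper bounds of sets `r` have order type less than `κ`,
then for each `ξ` either `ξ` is reached by successively adding elements of greedy sets, or the
choice of the least greedy elements joined to `ξ` by the colour `1` never stops. -/
theorem arrowTwo : ArrowTwo μ κ (succ (omega M)) := by
  rintro zero one two D f hzero hone htwo hD hf
  by_contra hcon
  push Not at hcon
  obtain ⟨hcon0, hcon1⟩ := hcon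
  rw [isEmp_iff] at hzero
  rw [isSucc_iff] at hone htwo
  set c : M → M → M := fun x y => app f (upair x y) with hc
  have : DefMap₂ c := inferInstanceAs <| DefMap₂ fun x y => app f (upair x y)
  have hDm : ∀ x y, x ∈ₘ μ → y ∈ₘ μ → x ≠ y → upair x y ∈ₘ D := fun x y hx hy hne =>
    (hD _).2 ⟨x, y, hx, hy, hne, isUPair_iff.2 rfl⟩
  have hcomm : ∀ x y, c x y = c y x := fun x y => by simp only [hc, upair_comm x y]
  have hpair : ∀ H i, Incl H μ → (∀ x y, x ∈ₘ H → y ∈ₘ H → x ∈ₘ y → c x y = i) → IsHomog f H i := by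
    intro H i hH h x y d hx hy hne hd
    obtain rfl := isUPair_iff.1 hd
    rw [pairMem_iff, hf.mem_iff]
    refine ⟨hDm x y (hH x hx) (hH y hy) hne, ?_⟩
    rcases (hμ.1.mem (hH x hx)).trichotomy (hμ.1.mem (hH y hy)) with h1 | h1 | h1
    · exact (h x y hx hy h1).symm
    · exact absurd h1 hne
    · exact ((hcomm x y).trans (h y x hy hx h1)).symm
  have hc01 : ∀ x y, y ∈ₘ μ → x ∈ₘ y → c x y ≠ zero → c x y = one := fun x y hy hxy h0 => by
    have := hf.app_mem (hDm x y (hμ.1.trans hy hxy) hy fun e => not_mem_self y (e ▸ hxy))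
    rw [htwo, mem_succ] at this
    rcases this with h | h
    · rw [hone, mem_succ, hzero] at h
      exact absurd (h.resolve_left not_mem_emp) (hzero ▸ h0)
    · exact h
  set X : M → M := fun r => sep μ fun ξ => ∀ η, η ∈ₘ r → η ∈ₘ ξ ∧ c η ξ = one with hX
  have : DefMap₁ X := inferInstanceAs <| DefMap₁ fun r =>
    sep μ fun ξ => ∀ η, η ∈ₘ r → η ∈ₘ ξ ∧ c η ξ = one
  set B : M → M := fun r => greedy (X r) fun η ξ => c η ξ = zero with hB
  have : DefMap₁ B := inferInstanceAs <| DefMap₁ fun r => greedy (X r) fun η ξ => c η ξ = zero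
  have hBmem : ∀ r ξ, ξ ∈ₘ B r ↔ ξ ∈ₘ X r ∧ ∀ η, η ∈ₘ B r → η ∈ₘ ξ → c η ξ = zero := fun r ξ =>
    mem_greedy hμ.1 fun x hx => (mem_sep.1 hx).1
  have hBX : ∀ r ξ, ξ ∈ₘ B r → ξ ∈ₘ μ ∧ ∀ η, η ∈ₘ r → η ∈ₘ ξ ∧ c η ξ = one := fun r ξ hξ =>
    mem_sep.1 ((hBmem r ξ).1 hξ).1
  have hBo : ∀ r ξ, ξ ∈ₘ B r → IsOrd ξ := fun r ξ hξ => hμ.1.mem (hBX r ξ hξ).1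
  have hBrk : ∀ r ξ, ξ ∈ₘ B r → rk (B r) ξ ∈ₘ κ := fun r ξ hξ => by
    by_contra h
    obtain ⟨H, hH, hot, -⟩ := exists_hasOrderType (hBo r) hκ.isOrd hξ h
    have hHμ : Incl H μ := fun x hx => (hBX r x (hH x hx)).1
    exact hcon0 H hHμ hot (hpair H zero hHμ fun x y hx hy hxy =>
      ((hBmem r y).1 (hH y hy)).2 x (hH x hx) hxy)
  obtain ⟨R, hR, hroot, hstep⟩ := exists_tree hκ μ (emp M) B (fun r ξ => rk (B r) ξ)
    (fun z hz => absurd hz not_mem_emp) (fun r ξ hξ => (hBX r ξ hξ).1) hBrk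
    (fun r x y hx hy e => rk_inj (hBo r) hx hy e)
  -- each `ξ` lies in the greedy set of some node `r`
  have hreach : ∀ ξ, ξ ∈ₘ μ → ∃ r, r ∈ₘ R ∧ ξ ∈ₘ B r := by
    intro ξ hξ
    by_contra hno
    push Not at hno
    have hξo := hμ.1.mem hξ
    set Θ : M → M := fun r => least (sep (B r) fun η => η ∈ₘ ξ ∧ c η ξ = one) with hΘ
    have : DefMap₁ Θ := inferInstanceAs <| DefMap₁ fun r =>
      least (sep (B r) fun η => η ∈ₘ ξ ∧ c η ξ = one)
    have hΘr : ∀ r, r ∈ₘ R → ξ ∈ₘ X r → Θ r ∈ₘ B r ∧ Θ r ∈ₘ ξ ∧ c (Θ r) ξ = one := by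
      intro r hr hξX
      have h := hno r hr
      rw [hBmem, and_iff_right hξX] at h
      push Not at h
      obtain ⟨η, hη, hηξ, h⟩ := h
      exact mem_sep.1 (least_spec (fun x hx => hBo r x (mem_sep.1 hx).1)
        ⟨η, mem_sep.2 ⟨hη, hηξ, hc01 η ξ hξ hηξ h⟩⟩).1
    set F : M → M := fun x => wfRec (fun x => x) (fun _ s => Θ s) x with hF
    have : DefMap₁ F := inferInstanceAs <| DefMap₁ fun x => wfRec (fun x => x) (fun _ s => Θ s) x
    have hFeq : ∀ k, IsNat k → F k = Θ (image F k) := fun k hk =>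
      isOrd_omega.wfOn.wfRec_eq (fun _ s => Θ s) (mem_omega.2 hk)
    have hFR : ∀ k, IsNat k → image F k ∈ₘ R ∧ ξ ∈ₘ X (image F k) := fun k hk => by
      refine IsNat.induction (fun k => image F k ∈ₘ R ∧ ξ ∈ₘ X (image F k)) ?_ ?_ hk
      · rw [show image F (emp M) = emp M from eq_emp fun z hz => by simp at hz]
        exact ⟨hroot, mem_sep.2 ⟨hξ, fun η hη => absurd hη not_mem_emp⟩⟩
      · rintro k hk ⟨ih1, ih2⟩
        have e : image F (succ k) = adj (image F k) (F k) := ext fun z => by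
          simp only [mem_image, mem_adj, mem_succ]
          constructor
          · rintro ⟨x, hx | rfl, rfl⟩
            exacts [.inl ⟨x, hx, rfl⟩, .inr rfl]
          · rintro (⟨x, hx, rfl⟩ | rfl)
            exacts [⟨x, .inl hx, rfl⟩, ⟨k, .inr rfl, rfl⟩]
        obtain ⟨h1, h2⟩ := hΘr _ ih1 ih2
        rw [← hFeq k hk] at h1 h2
        rw [e]
        refine ⟨hstep _ _ ih1 h1, mem_sep.2 ⟨hξ, fun η hη => ?_⟩⟩
        rcases mem_adj.1 hη with hη | rfl
        exacts [(mem_sep.1 ih2).2 η hη, h2]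
    have hF1 : ∀ k, IsNat k → F k ∈ₘ B (image F k) ∧ F k ∈ₘ ξ ∧ c (F k) ξ = one := fun k hk => by
      have := hΘr _ (hFR k hk).1 (hFR k hk).2
      rwa [← hFeq k hk] at this
    -- the values of `F` on the natural numbers, followed by `ξ`
    classical
    set g : M → M := fun x => if x = omega M then ξ else F x with hg
    have : DefMap₁ g := inferInstanceAs <| DefMap₁ fun x => if x = omega M then ξ else F x
    have hgω : g (omega M) = ξ := if_pos rfl
    have hgn : ∀ k, IsNat k → g k = F k := fun k hk => if_neg fun e =>
      not_mem_self k (by rw [e]; exact mem_omega.2 (e ▸ hk))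
    have hgg : ∀ i j, j ∈ₘ succ (omega M) → i ∈ₘ j → g i ∈ₘ g j ∧ c (g i) (g j) = one := by
      intro i j hj hij
      rcases mem_succ.1 hj with hj | rfl
      · rw [mem_omega] at hj
        have hi := hj.mem hij
        rw [hgn i hi, hgn j hj]
        exact (hBX _ _ (hF1 j hj).1).2 (F i) (mem_image.2 ⟨i, hij, rfl⟩)
      · rw [mem_omega] at hij
        rw [hgω, hgn i hij]
        exact (hF1 i hij).2
    have hgμ : ∀ i, i ∈ₘ succ (omega M) → g i ∈ₘ μ := fun i hi => by
      rcases mem_succ.1 hi with hi | rfl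
      · rw [mem_omega] at hi
        rw [hgn i hi]
        exact hμ.1.trans hξ (hF1 i hi).2.1
      · rwa [hgω]
    have hHμ : Incl (image g (succ (omega M))) μ := fun x hx => by
      obtain ⟨i, hi, rfl⟩ := mem_image.1 hx
      exact hgμ i hi
    refine hcon1 (image g (succ (omega M))) hHμ ⟨lam g (succ (omega M)),
      isFunc_lam fun i hi => mem_image.2 ⟨i, hi, rfl⟩, fun y hy => ?_, fun i j x y hx hy hij => ?_⟩
      (hpair _ _ hHμ fun x y hx hy hxy => ?_)
    · obtain ⟨i, hi, rfl⟩ := mem_image.1 hy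
      exact ⟨i, pairMem_iff.2 (mem_lam.2 ⟨i, hi, rfl⟩)⟩
    · simp only [pairMem_iff, mem_lam, opair_inj] at hx hy
      obtain ⟨i, hi, rfl, rfl⟩ := hx
      obtain ⟨j, hj, rfl, rfl⟩ := hy
      exact (hgg i j hj hij).1
    · obtain ⟨i, hi, rfl⟩ := mem_image.1 hx
      obtain ⟨j, hj, rfl⟩ := mem_image.1 hy
      have hω := (isOrd_omega (M := M)).succ
      rcases (hω.mem hi).trichotomy (hω.mem hj) with h | rfl | h
      · exact (hgg i j hj h).2
      · exact absurd hxy (not_mem_self _)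
      · exact absurd hxy (not_mem_cycle (hgg j i hi h).1)
  refine hμ.not_cardLE hκμ (hR.of_cover hκ.isOrd (fun r ξ => ξ ∈ₘ r ∧ Incl r (succ ξ))
    (fun ξ hξ => ?_) fun r ξ η _ _ _ h h' => eq_of_greatest h h')
  obtain ⟨r, hr, hξB⟩ := hreach ξ hξ
  refine ⟨_, hstep r ξ hr hξB, by simp, fun z hz => ?_⟩
  rcases mem_adj.1 hz with hz | rfl
  · exact mem_succ.2 (.inl ((hBX r ξ hξB).2 z hz).1)
  · simp

end Combinatorics

end InZF

theorem mainTheorem3 {M : Type*} [setLang.Structure M] (hM : IsModelZF M)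
    (κ : M) (hκ : IsInfCard κ) :
    ∃ μ ω ω' : M, IsSuccCard μ κ ∧ IsOmega ω ∧ IsSucc ω' ω ∧
      ArrowOne μ κ κ ∧
      TreeBound κ κ ∧
      Regressive μ κ ∧
      DeltaArrow μ κ ∧
      ArrowTwo μ κ ω' := by
  have : ZFModel M := ⟨hM⟩
  obtain ⟨μ, hμ⟩ := exists_isSuccCard hκ.1
  exact ⟨μ, omega M, succ (omega M), hμ, fun _ => mem_omega, isSucc_iff.2 rfl,
    arrowOne hκ hμ.1 hμ.2.1, treeBound hκ, regressive hκ hμ.1 hμ.2.1, deltaArrow hκ hμ.1 hμ.2.1,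
    arrowTwo hκ hμ.1 hμ.2.1⟩
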